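/- Conventions. A super-ring is a $\mathbb{Z}/2$-graded ring with unity $A=A_0\oplus A_1$; all super-rings are super-commutative, i.e. $rs=sr$ whenever $r\in A_0$ and $s\in A_0\cup A_1$, and $s^2=0$ for every $s\in A_1$. A super-ideal is a $\mathbb{Z}/2$-graded ideal; it is maximal if the quotient by it is a field. $A$ is Noetherian if its super-ideals satisfy the ascending chain condition, and local if it has a unique maximal super-ideal $\mathfrak m$. Put $I_A=AA_1$, the ideal generated by $A_1$, and $\overline A=A/I_A$, which is a commutative ring. Elements $y_1,\dots,y_s\in A_1$ form a system of odd parameters if $\mathrm{Kdim}(A_0)=\mathrm{Kdim}\bigl(A_0/\mathrm{Ann}_{A_0}(y_1\cdots y_s)\bigr)$, where $\mathrm{Kdim}$ denotes Krull dimension (for $s=0$ the product is $1$). Let $\mathrm{Ksdim}_0(A)=\mathrm{Kdim}(A_0)$, and let $\mathrm{Ksdim}_1(A)$ be the largest length $s$ of a system of odd parameters. A local Noetherian super-ring $(A,\mathfrak m)$ with residue field $K=A/\mathfrak m$ is called regular if $$\mathrm{Ksdim}_0(A)=\dim_K (\mathfrak m/\mathfrak m^2)_0\quad\text{and}\quad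 \mathrm{Ksdim}_1(A)=\dim_K (\mathfrak m/\mathfrak m^2)_1 ,$$ where $(\mathfrak m/\mathfrak m^2)_i$ is the component of parity $i$ of $\mathfrak m/\mathfrak m^2$. Let $\mathrm{gr}_{I_A}(A)=\bigoplus_{n\ge 0} I_A^n/I_A^{n+1}$, a graded $\overline A$-algebra, and let $\lambda_A:\wedge_{\overline A}(I_A/I_A^2)\to \mathrm{gr}_{I_A}(A)$ be the $\overline A$-algebra map induced by the inclusion of $I_A/I_A^2$ as the component of degree $1$. Proposition. For a local Noetherian super-ring $A$ the following are equivalent: (a) $A$ is regular; (b) (i) $\overline A$ is a regular local ring, (ii) the $\overline A$-module $I_A/I_A^2$ is free, and (iii) $\lambda_A$ is an isomorphism; (b') (i) $\overline A$ is a regular local ring, (ii) the $\overline A$-module $I_A/I_A^2$ is free of rank $\mathrm{Ksdim}_1(A)$, and (iii) $\lambda_A$ is an isomorphism. -/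

import Mathlib

/-! ### The associated graded ring of a two-sided ideal of a (not necessarily commutative) ring -/

section AssocGraded

variable {A : Type*} [Ring A] (I : Ideal A)

/-- The quotient `I ^ n / I ^ (n + 1)`, for an ideal `I` (with `I ^ 0 = A`). -/
abbrev GrPiece (n : ℕ) : Type _ := ↥(I ^ n) ⧸ (I ^ (n + 1)).submoduleOf (I ^ n)

namespace GrPiece

/-- The class in `I ^ n / I ^ (n + 1)` of an element of `I ^ n`. -/
abbrev mk (n : ℕ) (x : ↥(I ^ n)) : GrPiece I n := Submodule.Quotient.mk x

variable {I}

theorem mk_eq_mk_iff {n : ℕ} {x y : ↥(I ^ n)} :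
    mk I n x = mk I n y ↔ (x : A) - y ∈ I ^ (n + 1) := by
  rw [Submodule.Quotient.eq]; rfl

theorem mk_surjective (n : ℕ) : Function.Surjective (mk I n) :=
  Submodule.Quotient.mk_surjective _

theorem sigma_mk_eq {m n : ℕ} (h : m = n) (x : ↥(I ^ m)) (y : ↥(I ^ n)) (hxy : (x : A) = y) :
    (GradedMonoid.mk m (mk I m x) : GradedMonoid (GrPiece I)) = GradedMonoid.mk n (mk I n y) := by
  subst h
  obtain rfl : x = y := Subtype.ext hxy
  rfl

variable [I.IsTwoSided]

theorem mul_mem_pow {m n : ℕ} {x y : A} (hx : x ∈ I ^ m) (hy : y ∈ I ^ n) :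
    x * y ∈ I ^ (m + n) := by
  rw [Ideal.IsTwoSided.pow_add]
  exact Ideal.mul_mem_mul hx hy

theorem isTorsionBySet (n : ℕ) : Module.IsTorsionBySet A (GrPiece I n) (I : Set A) := by
  rw [Module.isTorsionBySet_quotient_iff]
  intro x r hr
  change r * (x : A) ∈ I ^ (n + 1)
  rw [Ideal.IsTwoSided.pow_succ]
  exact Ideal.mul_mem_mul hr x.2

/-- `I ^ n / I ^ (n + 1)` is a module over `A / I`, through left multiplication. -/
instance instModuleQuotient (n : ℕ) : Module (A ⧸ I) (GrPiece I n) :=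
  (isTorsionBySet n).module

/-- The multiplication
`I ^ m / I ^ (m + 1) × I ^ n / I ^ (n + 1) → I ^ (m + n) / I ^ (m + n + 1)`
induced by the multiplication of `A`. -/
def mul {m n : ℕ} (a : GrPiece I m) (b : GrPiece I n) : GrPiece I (m + n) :=
  Quotient.liftOn₂ a b (fun x y => mk I (m + n) ⟨(x : A) * (y : A), mul_mem_pow x.2 y.2⟩) (by
    intro x y x' y' h h'
    have hx : (x : A) - x' ∈ I ^ (m + 1) := mk_eq_mk_iff.1 (Quotient.sound h)
    have hy : (y : A) - y' ∈ I ^ (n + 1) := mk_eq_mk_iff.1 (Quotient.sound h')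
    rw [mk_eq_mk_iff]
    change (x : A) * y - x' * y' ∈ I ^ (m + n + 1)
    have e : (x : A) * y - x' * y' = (x - x') * y + x' * (y - y') := by noncomm_ring
    rw [e]
    refine add_mem ?_ ?_
    · have := mul_mem_pow hx y.2
      rwa [show m + 1 + n = m + n + 1 by omega] at this
    · have := mul_mem_pow x'.2 hy
      rwa [← add_assoc] at this)

instance instGMul : GradedMonoid.GMul (GrPiece I) where
  mul := mul

instance instGOne : GradedMonoid.GOne (GrPiece I) where
  one := mk I 0 ⟨1, by rw [Submodule.pow_zero, Ideal.one_eq_top]; trivial⟩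

instance instGRing : DirectSum.GRing (GrPiece I) where
  mul_zero {m n} a := by
    obtain ⟨x, rfl⟩ := mk_surjective m a
    exact congrArg (mk I _) (Subtype.ext (mul_zero (x : A)))
  zero_mul {m n} b := by
    obtain ⟨y, rfl⟩ := mk_surjective n b
    exact congrArg (mk I _) (Subtype.ext (zero_mul (y : A)))
  mul_add {m n} a b c := by
    obtain ⟨x, rfl⟩ := mk_surjective m a
    obtain ⟨y, rfl⟩ := mk_surjective n b
    obtain ⟨z, rfl⟩ := mk_surjective n c
    exact congrArg (mk I _) (Subtype.ext (mul_add (x : A) y z))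
  add_mul {m n} a b c := by
    obtain ⟨x, rfl⟩ := mk_surjective m a
    obtain ⟨y, rfl⟩ := mk_surjective m b
    obtain ⟨z, rfl⟩ := mk_surjective n c
    exact congrArg (mk I _) (Subtype.ext (add_mul (x : A) y z))
  one_mul := by
    rintro ⟨n, a⟩
    obtain ⟨x, rfl⟩ := mk_surjective n a
    exact sigma_mk_eq (zero_add n) _ _ (one_mul (x : A))
  mul_one := by
    rintro ⟨n, a⟩
    obtain ⟨x, rfl⟩ := mk_surjective n a
    exact sigma_mk_eq (add_zero n) _ _ (mul_one (x : A))
  mul_assoc := by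
    rintro ⟨l, a⟩ ⟨m, b⟩ ⟨n, c⟩
    obtain ⟨x, rfl⟩ := mk_surjective l a
    obtain ⟨y, rfl⟩ := mk_surjective m b
    obtain ⟨z, rfl⟩ := mk_surjective n c
    exact sigma_mk_eq (add_assoc l m n) _ _ (mul_assoc (x : A) y z)
  natCast k := mk I 0 ⟨(k : A), by rw [Submodule.pow_zero, Ideal.one_eq_top]; trivial⟩
  natCast_zero := congrArg (mk I _) (Subtype.ext Nat.cast_zero)
  natCast_succ k := congrArg (mk I _) (Subtype.ext (Nat.cast_succ k))
  intCast k := mk I 0 ⟨(k : A), by rw [Submodule.pow_zero, Ideal.one_eq_top]; trivial⟩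
  intCast_ofNat k := congrArg (mk I _) (Subtype.ext (Int.cast_natCast k))
  intCast_negSucc_ofNat k := congrArg (mk I _) (Subtype.ext (Int.cast_negSucc k))

end GrPiece

/-- The associated graded ring `gr_I(A) = ⨁ n, I ^ n / I ^ (n + 1)`. -/
abbrev AssocGr : Type _ := DirectSum ℕ (GrPiece I)

end AssocGraded

/-! ### Super-commutative super-rings

A super-ring is a ring `A` with a `ℤ/2`-grading `𝒜`, that is, `A = 𝒜 0 ⊕ 𝒜 1`. -/

section SuperRing

variable {A : Type*} [Ring A] (𝒜 : ZMod 2 → AddSubgroup A) [GradedRing 𝒜]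

/-- Super-commutativity: even elements commute with homogeneous ones, and odd elements have
square zero. -/
class IsSuperCommutative : Prop where
  even_mul_even : ∀ r ∈ 𝒜 0, ∀ s ∈ 𝒜 0, r * s = s * r
  even_mul_odd : ∀ r ∈ 𝒜 0, ∀ s ∈ 𝒜 1, r * s = s * r
  odd_mul_self : ∀ s ∈ 𝒜 1, s * s = 0

/-- A super-ring is Noetherian if its super-ideals (the graded ideals) satisfy the ascending chain
condition. -/
class IsNoetherianSuperRing : Prop where
  wellFoundedGT : WellFoundedGT (HomogeneousIdeal 𝒜)

/-- The ideal `A * 𝒜 1` generated by the odd elements. -/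
def oddIdeal : Ideal A := Ideal.span (𝒜 1 : Set A)

namespace SuperRing

theorem eq_even_add_odd (a : A) :
    a = (DirectSum.decompose 𝒜 a 0 : A) + (DirectSum.decompose 𝒜 a 1 : A) := by
  classical
  conv_lhs => rw [← DirectSum.sum_support_decompose 𝒜 a]
  rw [Finset.sum_subset (Finset.subset_univ _)]
  · exact Fin.sum_univ_two (fun i : ZMod 2 => ((DirectSum.decompose 𝒜 a i : 𝒜 i) : A))
  · intro i _ hi
    simpa using hi

theorem exists_even_add_odd (a : A) : ∃ x ∈ 𝒜 0, ∃ y ∈ 𝒜 1, a = x + y :=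
  ⟨_, (DirectSum.decompose 𝒜 a 0).2, _, (DirectSum.decompose 𝒜 a 1).2, eq_even_add_odd 𝒜 a⟩

theorem oddIdeal_isHomogeneous : (oddIdeal 𝒜).IsHomogeneous 𝒜 :=
  Ideal.homogeneous_span 𝒜 _ fun _ hx => ⟨1, hx⟩

variable [IsSuperCommutative 𝒜]

theorem even_comm {r : A} (hr : r ∈ 𝒜 0) (a : A) : r * a = a * r := by
  obtain ⟨x, hx, y, hy, rfl⟩ := exists_even_add_odd 𝒜 a
  rw [mul_add, add_mul, IsSuperCommutative.even_mul_even r hr x hx,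
    IsSuperCommutative.even_mul_odd r hr y hy]

theorem odd_anticomm {r s : A} (hr : r ∈ 𝒜 1) (hs : s ∈ 𝒜 1) : r * s = -(s * r) := by
  have h := IsSuperCommutative.odd_mul_self (𝒜 := 𝒜) (r + s) (add_mem hr hs)
  rw [mul_add, add_mul, add_mul, IsSuperCommutative.odd_mul_self r hr,
    IsSuperCommutative.odd_mul_self s hs, zero_add, add_zero] at h
  exact eq_neg_of_add_eq_zero_right h

theorem isTwoSided_of_isHomogeneous {I : Ideal A} (hI : I.IsHomogeneous 𝒜) : I.IsTwoSided := by
  refine ⟨fun {a} b ha => ?_⟩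
  have h0 : (DirectSum.decompose 𝒜 a 0 : A) ∈ I := hI 0 ha
  have h1 : (DirectSum.decompose 𝒜 a 1 : A) ∈ I := hI 1 ha
  rw [eq_even_add_odd 𝒜 a, add_mul]
  refine add_mem ?_ ?_
  · rw [even_comm 𝒜 (DirectSum.decompose 𝒜 a 0).2]
    exact I.mul_mem_left b h0
  · obtain ⟨x, hx, y, hy, rfl⟩ := exists_even_add_odd 𝒜 b
    rw [mul_add, ← even_comm 𝒜 hx, odd_anticomm 𝒜 (DirectSum.decompose 𝒜 a 1).2 hy]
    exact add_mem (I.mul_mem_left x h1) (I.neg_mem (I.mul_mem_left y h1))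

instance instIsTwoSidedHomogeneous (P : HomogeneousIdeal 𝒜) : P.toIdeal.IsTwoSided :=
  isTwoSided_of_isHomogeneous 𝒜 P.isHomogeneous

instance instIsTwoSidedOddIdeal : (oddIdeal 𝒜).IsTwoSided :=
  isTwoSided_of_isHomogeneous 𝒜 (oddIdeal_isHomogeneous 𝒜)

/-- The even part `𝒜 0` is a commutative ring. -/
instance instCommRingEven : CommRing (𝒜 0) :=
  { (inferInstance : Ring (𝒜 0)) with
    mul_comm := fun r s => Subtype.ext (even_comm 𝒜 r.2 (s : A)) }

theorem exists_even_mk_eq (c : A ⧸ oddIdeal 𝒜) :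
    ∃ x ∈ 𝒜 0, Ideal.Quotient.mk (oddIdeal 𝒜) x = c := by
  obtain ⟨a, rfl⟩ := Ideal.Quotient.mk_surjective c
  obtain ⟨x, hx, y, hy, rfl⟩ := exists_even_add_odd 𝒜 a
  refine ⟨x, hx, ?_⟩
  have hy' : y ∈ oddIdeal 𝒜 := Ideal.subset_span hy
  rw [map_add, Ideal.Quotient.eq_zero_iff_mem.2 hy', add_zero]

/-- The quotient of `A` by the ideal generated by the odd elements is a commutative ring. -/
instance instCommRingBar : CommRing (A ⧸ oddIdeal 𝒜) :=
  { Ideal.Quotient.ring (oddIdeal 𝒜) with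
    mul_comm := fun a b => by
      obtain ⟨x, hx, rfl⟩ := exists_even_mk_eq 𝒜 a
      obtain ⟨y, rfl⟩ := Ideal.Quotient.mk_surjective b
      exact congrArg (Ideal.Quotient.mk (oddIdeal 𝒜)) (even_comm 𝒜 hx y) }

end SuperRing

variable [IsSuperCommutative 𝒜]

/-- A super-ideal is maximal if the quotient by it is a field. -/
def IsMaximalSuperIdeal (P : HomogeneousIdeal 𝒜) : Prop := IsField (A ⧸ P.toIdeal)

/-- A super-ring is local if it has exactly one maximal super-ideal. -/
class IsLocalSuperRing : Prop where
  existsUnique_maximal : ∃! P : HomogeneousIdeal 𝒜, IsMaximalSuperIdeal 𝒜 P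

/-- The maximal super-ideal `𝔪` of a local super-ring. -/
noncomputable def maximalSuperIdeal [IsLocalSuperRing 𝒜] : HomogeneousIdeal 𝒜 :=
  (IsLocalSuperRing.existsUnique_maximal (𝒜 := 𝒜)).choose

/-- For `P` a maximal super-ideal with residue field `K = A / P`: the component of parity `i` of the
super-vector space `P / P ^ 2` over `K`, that is, the subspace of the classes of the elements
of `P` of parity `i`. -/
def cotangentComponent (P : HomogeneousIdeal 𝒜) (i : ZMod 2) :
    Submodule (A ⧸ P.toIdeal) (GrPiece P.toIdeal 1) :=
  Submodule.span (A ⧸ P.toIdeal)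
    {v | ∃ x : ↥(P.toIdeal ^ 1), (x : A) ∈ 𝒜 i ∧ GrPiece.mk P.toIdeal 1 x = v}

/-- The annihilator in the even part `𝒜 0` of an element of `A`. -/
def evenAnnihilator (a : A) : Ideal (𝒜 0) where
  carrier := {r | (r : A) * a = 0}
  add_mem' {r s} hr hs := by
    change ((r : A) + s) * a = 0
    rw [add_mul, hr, hs, add_zero]
  zero_mem' := zero_mul a
  smul_mem' c r hr := by
    change ((c : A) * r) * a = 0
    rw [mul_assoc, hr, mul_zero]

/-- The odd elements `y 0, …, y (s - 1)` form a system of odd parameters if dividing `𝒜 0` by the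
annihilator of their product does not lower the Krull dimension. -/
def IsSystemOfOddParameters {s : ℕ} (y : Fin s → 𝒜 1) : Prop :=
  ringKrullDim (𝒜 0) =
    ringKrullDim (𝒜 0 ⧸ evenAnnihilator 𝒜 (List.ofFn fun i => (y i : A)).prod)

/-- The even Krull dimension of a super-ring. -/
noncomputable def evenKrullDim : WithBot ℕ∞ := ringKrullDim (𝒜 0)

/-- The odd Krull dimension of a super-ring: the largest length of a system of odd parameters. -/
noncomputable def oddKrullDim : ℕ∞ :=
  ⨆ (s : ℕ) (_ : ∃ y : Fin s → 𝒜 1, IsSystemOfOddParameters 𝒜 y), (s : ℕ∞)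

/-- A local (Noetherian) super-ring is regular if its Krull super-dimension equals the
super-dimension of `𝔪 / 𝔪 ^ 2` over the residue field `A / 𝔪`. -/
def IsRegularLocalSuperRing [IsLocalSuperRing 𝒜] : Prop :=
  evenKrullDim 𝒜 = (Module.finrank (A ⧸ (maximalSuperIdeal 𝒜).toIdeal)
    (cotangentComponent 𝒜 (maximalSuperIdeal 𝒜) 0) : ℕ) ∧
  oddKrullDim 𝒜 = (Module.finrank (A ⧸ (maximalSuperIdeal 𝒜).toIdeal)
    (cotangentComponent 𝒜 (maximalSuperIdeal 𝒜) 1) : ℕ)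

/-! ### The associated graded algebra of the odd ideal, and the map from the exterior algebra -/

namespace SuperRing

/-- `gr(A)`, for the ideal generated by the odd elements, is an algebra over its component of
degree zero. -/
instance instGAlgebra : DirectSum.GAlgebra (A ⧸ oddIdeal 𝒜) (GrPiece (oddIdeal 𝒜)) where
  toFun := QuotientAddGroup.lift (oddIdeal 𝒜).toAddSubgroup
    { toFun := fun a => GrPiece.mk (oddIdeal 𝒜) 0
        ⟨a, by rw [Submodule.pow_zero, Ideal.one_eq_top]; trivial⟩
      map_zero' := rfl
      map_add' := fun _ _ => rfl }
    (fun a ha => by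
      refine (GrPiece.mk_eq_mk_iff (y := 0)).2 ?_
      change a - 0 ∈ (oddIdeal 𝒜) ^ (0 + 1)
      rw [sub_zero, zero_add, Submodule.pow_one]
      exact ha)
  map_one := rfl
  map_mul r s := by
    obtain ⟨a, rfl⟩ := Ideal.Quotient.mk_surjective r
    obtain ⟨b, rfl⟩ := Ideal.Quotient.mk_surjective s
    exact GrPiece.sigma_mk_eq rfl ⟨a * b, _⟩ ⟨a * b, _⟩ rfl
  commutes r x := by
    obtain ⟨n, x⟩ := x
    obtain ⟨a, ha, rfl⟩ := exists_even_mk_eq 𝒜 r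
    obtain ⟨b, rfl⟩ := GrPiece.mk_surjective n x
    exact GrPiece.sigma_mk_eq (Nat.add_comm 0 n) ⟨a * b, _⟩ ⟨b * a, _⟩ (even_comm 𝒜 ha (b : A))
  smul_def r x := by
    obtain ⟨n, x⟩ := x
    obtain ⟨a, rfl⟩ := Ideal.Quotient.mk_surjective r
    obtain ⟨b, rfl⟩ := GrPiece.mk_surjective n x
    exact GrPiece.sigma_mk_eq (Nat.zero_add n).symm (a • b) ⟨a * b, _⟩ rfl

theorem exists_odd_sub_mem {a : A} (ha : a ∈ oddIdeal 𝒜) :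
    ∃ y ∈ 𝒜 1, a - y ∈ oddIdeal 𝒜 ^ 2 := by
  induction ha using Submodule.span_induction with
  | mem y hy => exact ⟨y, hy, by simp⟩
  | zero => exact ⟨0, zero_mem _, by simp⟩
  | add a b _ _ iha ihb =>
    obtain ⟨y, hy, h⟩ := iha
    obtain ⟨z, hz, h'⟩ := ihb
    refine ⟨y + z, add_mem hy hz, ?_⟩
    rw [add_sub_add_comm]
    exact add_mem h h'
  | smul c a _ iha =>
    obtain ⟨y, hy, h⟩ := iha
    obtain ⟨u, hu, v, hv, rfl⟩ := exists_even_add_odd 𝒜 c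
    refine ⟨u * y, by simpa using SetLike.mul_mem_graded hu hy, ?_⟩
    have e : (u + v) • a - u * y = (u + v) * (a - y) + v * y := by
      rw [smul_eq_mul]; noncomm_ring
    rw [e]
    refine add_mem (Ideal.mul_mem_left _ _ h) ?_
    have hv' : v ∈ oddIdeal 𝒜 ^ 1 := by
      rw [Submodule.pow_one]; exact Ideal.subset_span hv
    have hy' : y ∈ oddIdeal 𝒜 ^ 1 := by
      rw [Submodule.pow_one]; exact Ideal.subset_span hy
    exact GrPiece.mul_mem_pow hv' hy'

theorem lof_mul_self (v : GrPiece (oddIdeal 𝒜) 1) :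
    DirectSum.lof (A ⧸ oddIdeal 𝒜) ℕ (GrPiece (oddIdeal 𝒜)) 1 v *
      DirectSum.lof (A ⧸ oddIdeal 𝒜) ℕ (GrPiece (oddIdeal 𝒜)) 1 v = 0 := by
  obtain ⟨x, rfl⟩ := GrPiece.mk_surjective 1 v
  have hx : (x : A) ∈ oddIdeal 𝒜 := (Submodule.pow_one (oddIdeal 𝒜)).le x.2
  obtain ⟨y, hy, h⟩ := exists_odd_sub_mem 𝒜 hx
  have hy' : y ∈ oddIdeal 𝒜 ^ 1 := by
    rw [Submodule.pow_one]; exact Ideal.subset_span hy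
  have e : GrPiece.mk (oddIdeal 𝒜) 1 x = GrPiece.mk (oddIdeal 𝒜) 1 ⟨y, hy'⟩ :=
    GrPiece.mk_eq_mk_iff.2 h
  rw [e, DirectSum.lof_eq_of, DirectSum.of_mul_of]
  have e' : GradedMonoid.GMul.mul (GrPiece.mk (oddIdeal 𝒜) 1 ⟨y, hy'⟩)
      (GrPiece.mk (oddIdeal 𝒜) 1 ⟨y, hy'⟩) = 0 :=
    congrArg (GrPiece.mk (oddIdeal 𝒜) (1 + 1))
      (Subtype.ext (IsSuperCommutative.odd_mul_self (𝒜 := 𝒜) y hy))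
  rw [e', map_zero]

end SuperRing

/-- The algebra map from the exterior algebra of `I / I ^ 2` over `A / I` to `gr_I(A)`, where `I` is
the ideal generated by the odd elements, extending the inclusion of `I / I ^ 2` as the component
of degree one. -/
noncomputable def exteriorToGr :
    ExteriorAlgebra (A ⧸ oddIdeal 𝒜) (GrPiece (oddIdeal 𝒜) 1) →ₐ[A ⧸ oddIdeal 𝒜]
      AssocGr (oddIdeal 𝒜) :=
  ExteriorAlgebra.lift (A ⧸ oddIdeal 𝒜)
    ⟨DirectSum.lof (A ⧸ oddIdeal 𝒜) ℕ (GrPiece (oddIdeal 𝒜)) 1, SuperRing.lof_mul_self 𝒜⟩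

end SuperRing

/-!
The kernel of `A₀ → Ā := A / I_A` is nilpotent, so `A₀` and `Ā` have the same Krull dimension, while
`(𝔪 / 𝔪²)₀` is the cotangent space of `Ā` and `dim (𝔪 / 𝔪²)₁` is the minimal number `t` of
generators of the `A₀`-module `A₁`. Hence `A` is regular if and only if `Ā` is regular and some, or
equivalently every, minimal generating family `x₁, …, x_t` of `A₁` is a system of odd parameters.

A regular local ring is a domain, so its dimension drops in every proper quotient. As the kernel of
`A₀ → Ā` annihilates `x₁ ⋯ x_t`, the odd parameter condition says that the annihilator of
`x₁ ⋯ x_t` is exactly this kernel, that is, that the top product of the classes of the `xᵢ` is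
torsion-free over `Ā`. This single condition in top degree already makes the classes a basis of
`I_A / I_A²` and `λ_A` injective, because every nonzero element of the exterior algebra on a finite
basis has a multiple that is a nonzero scalar times the top product.
-/

section RegularLocalRing

open IsLocalRing

variable {R : Type*} [CommRing R]

theorem spanFinrank_map_quotient_span_singleton_lt [IsLocalRing R] {I : Ideal R} (hI : I.FG)
    {x : R} (hxI : x ∈ I) (hx : x ∉ maximalIdeal R * I) :
    (I.map (Ideal.Quotient.mk (Ideal.span {x}))).spanFinrank < I.spanFinrank := by
  classical
  obtain ⟨s, hcard, hspan⟩ := Submodule.FG.exists_span_finset_card_eq_spanFinrank hI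
  have hsI : ∀ a ∈ s, a ∈ I := fun a ha => hspan ▸ Submodule.subset_span ha
  obtain ⟨c, -, hc⟩ := Submodule.mem_span_finset.1 (hspan ▸ hxI)
  obtain ⟨a, ha, hca⟩ : ∃ a ∈ s, IsUnit (c a) := by
    by_contra! hnonunit
    refine hx (hc ▸ sum_mem fun a ha => ?_)
    exact Ideal.mul_mem_mul ((mem_maximalIdeal _).2 (hnonunit a ha)) (hsI a ha)
  set π := Ideal.Quotient.mk (Ideal.span {x})
  have hπa : π a ∈ Ideal.span (π '' (s.erase a)) := by
    have hsum : π (c a) * π a = -∑ b ∈ s.erase a, π (c b) * π b := by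
      rw [eq_neg_iff_add_eq_zero, Finset.add_sum_erase s (fun b => π (c b) * π b) ha]
      simpa only [π, ← map_mul, ← map_sum] using
        Ideal.Quotient.eq_zero_iff_mem.2 (hc ▸ Ideal.mem_span_singleton_self x)
    rw [← Ideal.unit_mul_mem_iff_mem _ (hca.map π), hsum]
    exact neg_mem (sum_mem fun b hb =>
      Ideal.mul_mem_left _ _ (Ideal.subset_span ⟨b, hb, rfl⟩))
  have hmap : I.map π = Ideal.span (π '' (s.erase a)) := by
    rw [← hspan, Ideal.submodule_span_eq, Ideal.map_span]
    refine le_antisymm (Ideal.span_le.2 ?_) (Ideal.span_mono (Set.image_mono (s.erase_subset a)))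
    rintro _ ⟨b, hb, rfl⟩
    obtain rfl | hba := eq_or_ne b a
    · exact hπa
    · exact Ideal.subset_span ⟨b, Finset.mem_erase.2 ⟨hba, hb⟩, rfl⟩
  calc (I.map π).spanFinrank
      ≤ (π '' (s.erase a : Set R)).ncard :=
        hmap ▸ Submodule.spanFinrank_span_le_ncard_of_finite ((s.erase a).finite_toSet.image π)
    _ ≤ (s.erase a).card :=
        (Set.ncard_image_le (s.erase a).finite_toSet).trans_eq (Set.ncard_coe_finset _)
    _ < I.spanFinrank := hcard ▸ Finset.card_erase_lt_of_mem ha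

theorem isLocalRing_quotient_span_singleton [IsLocalRing R] {x : R} (hx : x ∈ maximalIdeal R) :
    IsLocalRing (R ⧸ Ideal.span {x}) :=
  have : Nontrivial (R ⧸ Ideal.span {x}) :=
    Ideal.Quotient.nontrivial_iff.2 (mt Ideal.span_singleton_eq_top.1 hx)
  .of_surjective' _ Ideal.Quotient.mk_surjective

theorem spanFinrank_maximalIdeal_quotient_span_singleton_lt [IsLocalRing R] [IsNoetherianRing R]
    {x : R} (hx : x ∈ maximalIdeal R) (hx2 : x ∉ maximalIdeal R ^ 2)
    [IsLocalRing (R ⧸ Ideal.span {x})] :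
    (maximalIdeal (R ⧸ Ideal.span {x})).spanFinrank < (maximalIdeal R).spanFinrank := by
  rw [← map_maximalIdeal_of_surjective _ Ideal.Quotient.mk_surjective]
  exact spanFinrank_map_quotient_span_singleton_lt (IsNoetherian.noetherian _) hx
    (sq (maximalIdeal R) ▸ hx2)

theorem isRegularLocalRing_quotient_span_singleton [IsRegularLocalRing R] {x : R}
    (hx : x ∈ maximalIdeal R) (hx2 : x ∉ maximalIdeal R ^ 2) :
    IsRegularLocalRing (R ⧸ Ideal.span {x}) := by
  have := isLocalRing_quotient_span_singleton hx
  refine .of_spanFinrank_maximalIdeal_le _ (ENat.WithBot.add_le_add_one_right_iff.1 ?_)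
  calc ((maximalIdeal (R ⧸ Ideal.span {x})).spanFinrank : WithBot ℕ∞) + 1
      ≤ (maximalIdeal R).spanFinrank := by
        exact_mod_cast spanFinrank_maximalIdeal_quotient_span_singleton_lt hx hx2
    _ = ringKrullDim R := IsRegularLocalRing.spanFinrank_maximalIdeal
    _ ≤ ringKrullDim (R ⧸ Ideal.span {x}) + 1 := by
        simpa using ringKrullDim_le_ringKrullDim_quotient_add_encard {x}
          (by simpa [ringJacobson_eq_maximalIdeal] using hx)

theorem eq_bot_of_le_maximalIdeal_mul [IsLocalRing R] {I : Ideal R} (hI : I.FG)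
    (h : I ≤ maximalIdeal R * I) : I = ⊥ :=
  Submodule.eq_bot_of_le_smul_of_le_jacobson_bot _ I hI h (maximalIdeal_le_jacobson _)

theorem exists_mem_maximalIdeal_notMem_sq_notMem_minimalPrimes [IsLocalRing R] [IsNoetherianRing R]
    (hdim : ringKrullDim R ≠ 0) :
    ∃ x ∈ maximalIdeal R, x ∉ maximalIdeal R ^ 2 ∧ ∀ p ∈ minimalPrimes R, x ∉ p := by
  have hsq : ¬ maximalIdeal R ≤ maximalIdeal R ^ 2 := fun hle => hdim <|
    ringKrullDim_eq_zero_of_isField <| isField_iff_maximalIdeal_eq.2 <|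
      eq_bot_of_le_maximalIdeal_mul (IsNoetherian.noetherian _) (sq (maximalIdeal R) ▸ hle)
  have hmin : ∀ p ∈ minimalPrimes R, ¬ maximalIdeal R ≤ p := fun p hp hle => hdim <| by
    have : p = maximalIdeal R := le_antisymm (le_maximalIdeal hp.1.1.ne_top) hle
    rw [← maximalIdeal_height_eq_ringKrullDim, Ideal.height_eq_zero_iff.2 (this ▸ hp)]
    rfl
  by_contra! hcover
  -- Prime avoidance allows one of the ideals, here `𝔪 ^ 2`, not to be prime.
  obtain ⟨p, rfl | hp, hle⟩ := (Ideal.subset_union_prime_finite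
    ((minimalPrimes.finite_of_isNoetherianRing R).insert (maximalIdeal R ^ 2)) (f := id)
    (maximalIdeal R ^ 2) (maximalIdeal R ^ 2)
    fun p hp hne _ => (Set.mem_of_mem_insert_of_ne hp hne).1.1).1 fun x hx => by
      by_cases hx2 : x ∈ maximalIdeal R ^ 2
      · exact Set.mem_biUnion (Set.mem_insert _ _) hx2
      · obtain ⟨p, hp, hxp⟩ := hcover x hx hx2
        exact Set.mem_biUnion (Set.mem_insert_of_mem _ hp) hxp
  · exact hsq hle
  · exact hmin p hp hle

theorem isDomain_of_isPrime_span_singleton [IsLocalRing R] [IsNoetherianRing R] {x : R}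
    (hx : x ∈ maximalIdeal R) (hprime : (Ideal.span {x}).IsPrime)
    (hmin : ∀ p ∈ minimalPrimes R, x ∉ p) : IsDomain R := by
  obtain ⟨q, hq, hqx⟩ := Ideal.exists_minimalPrimes_le (bot_le : ⊥ ≤ Ideal.span {x})
  have hqp : q.IsPrime := hq.1.1
  have hq0 : q = ⊥ := by
    refine eq_bot_of_le_maximalIdeal_mul (IsNoetherian.noetherian _) fun a ha => ?_
    obtain ⟨b, rfl⟩ := Ideal.mem_span_singleton'.1 (hqx ha)
    have hb : b ∈ q := (hqp.mem_or_mem ha).resolve_right (hmin q hq)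
    exact mul_comm x b ▸ Ideal.mul_mem_mul hx hb
  exact @IsDomain.of_bot_isPrime R _ (hq0 ▸ hqp)

theorem isDomain_of_isRegularLocalRing (R : Type*) [CommRing R] [IsRegularLocalRing R] :
    IsDomain R := by
  induction h : (maximalIdeal R).spanFinrank using Nat.strong_induction_on generalizing R with
  | _ d ih =>
  have hrank : (d : WithBot ℕ∞) = ringKrullDim R := h ▸ IsRegularLocalRing.spanFinrank_maximalIdeal
  by_cases hdim : ringKrullDim R = 0
  · have hd : d = 0 := by exact_mod_cast hrank.trans hdim
    have hbot := (Submodule.spanFinrank_eq_zero_iff_eq_bot (IsNoetherian.noetherian _)).1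
      (h.trans hd)
    exact (isField_iff_maximalIdeal_eq.2 hbot).isDomain
  · obtain ⟨x, hx, hx2, hmin⟩ := exists_mem_maximalIdeal_notMem_sq_notMem_minimalPrimes hdim
    have := isRegularLocalRing_quotient_span_singleton hx hx2
    have hdomain := ih _ (h ▸ spanFinrank_maximalIdeal_quotient_span_singleton_lt hx hx2)
      (R ⧸ Ideal.span {x}) rfl
    exact isDomain_of_isPrime_span_singleton hx
      ((Ideal.Quotient.isDomain_iff_prime _).1 hdomain) hmin

end RegularLocalRing

section KrullDimension

variable {R S : Type*} [CommRing R] [CommRing S]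

theorem ringKrullDim_quotient_eq_of_le_nilradical {I : Ideal R} (hI : I ≤ nilradical R) :
    ringKrullDim (R ⧸ I) = ringKrullDim R := by
  rw [ringKrullDim_quotient, (PrimeSpectrum.zeroLocus_eq_univ_iff _).2 hI, ringKrullDim]
  exact Order.krullDim_eq_of_orderIso OrderIso.Set.univ

theorem eq_bot_of_ringKrullDim_le_quotient [IsDomain R] [FiniteRingKrullDim R] {I : Ideal R}
    (hI : ringKrullDim R ≤ ringKrullDim (R ⧸ I)) : I = ⊥ := by
  by_contra hne
  obtain ⟨r, hr, hr0⟩ := Submodule.exists_mem_ne_zero_of_ne_bot hne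
  have hle : ringKrullDim (R ⧸ I) ≤ ringKrullDim (R ⧸ Ideal.span {r}) :=
    ringKrullDim_le_of_surjective _
      (Ideal.Quotient.factor_surjective ((Ideal.span_singleton_le_iff_mem I).2 hr))
  have hlt : ringKrullDim R + 1 ≤ ringKrullDim R :=
    (add_le_add_left (hI.trans hle) 1).trans
      (ringKrullDim_quotient_succ_le_of_nonZeroDivisor (mem_nonZeroDivisors_of_ne_zero hr0))
  rw [ringKrullDim, Order.krullDim_eq_length_of_finiteDimensionalOrder] at hlt
  exact absurd (by exact_mod_cast hlt) (Nat.not_succ_le_self _)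

theorem le_ker_of_ringKrullDim_le_quotient [IsDomain S] [FiniteRingKrullDim S] {f : R →+* S}
    (hf : Function.Surjective f) {I : Ideal R} (hle : RingHom.ker f ≤ I)
    (hdim : ringKrullDim S ≤ ringKrullDim (R ⧸ I)) : I ≤ RingHom.ker f := by
  have hker : RingHom.ker ((Ideal.Quotient.mk (I.map f)).comp f) = I := by
    rw [← RingHom.comap_ker, Ideal.mk_ker, Ideal.comap_map_of_surjective' f hf, sup_eq_left.2 hle]
  have e : R ⧸ I ≃+* S ⧸ I.map f := (Ideal.quotEquivOfEq hker.symm).trans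
    (RingHom.quotientKerEquivOfSurjective (Ideal.Quotient.mk_surjective.comp hf))
  have hbot : I.map f = ⊥ :=
    eq_bot_of_ringKrullDim_le_quotient (hdim.trans (ringKrullDim_eq_of_ringEquiv e).le)
  exact (Ideal.map_eq_bot_iff_le_ker f).1 hbot

end KrullDimension

section AlternatingMap

theorem linearIndependent_of_alternatingMap_smul_eq_zero {R M N : Type*} [CommRing R]
    [AddCommGroup M] [Module R M] [AddCommGroup N] [Module R N] {t : ℕ} {g : M [⋀^Fin t]→ₗ[R] N}
    {v : Fin t → M} (h : ∀ r : R, r • g v = 0 → r = 0) : LinearIndependent R v := by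
  refine Fintype.linearIndependent_iff.2 fun c hc i => h (c i) ?_
  calc c i • g v = ∑ j, c j • g (Function.update v i (v j)) := by
        rw [Finset.sum_eq_single_of_mem i (Finset.mem_univ i), Function.update_eq_self]
        intro j _ hji
        rw [g.map_update_self v hji.symm, smul_zero]
    _ = g (Function.update v i (∑ j, c j • v j)) := by
        simp only [g.map_update_sum, g.map_update_smul]
    _ = 0 := by rw [hc, g.map_update_zero]

end AlternatingMap

section ExteriorAlgebra

open Set.powersetCard

variable {R M : Type*} [CommRing R] [AddCommGroup M] [Module R M] {t : ℕ}

theorem ιMulti_family_eq_ιMulti (v : Fin t → M) (s : Set.powersetCard (Fin t) t) :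
    ExteriorAlgebra.ιMulti_family R t v s = ExteriorAlgebra.ιMulti R t v := by
  have h : ofFinEmbEquiv.symm s = RelEmbedding.refl _ := by
    refine DFunLike.coe_injective
      ((StrictMono.range_inj (OrderEmbedding.strictMono _) strictMono_id).1 ?_)
    rw [(Finite.surjective_of_injective (ofFinEmbEquiv.symm s).injective).range_eq, Set.range_id]
  rw [ExteriorAlgebra.ιMulti_family, h]
  rfl

theorem exteriorPower_eq_span_ιMulti {v : Fin t → M} (hv : Submodule.span R (Set.range v) = ⊤) :
    ⋀[R]^t M = Submodule.span R {ExteriorAlgebra.ιMulti R t v} := by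
  have : Nonempty (Set.powersetCard (Fin t) t) := ⟨ofCard (s := Finset.univ) (by simp)⟩
  rw [← exteriorPower.ιMulti_family_span_fixedDegree_of_span R hv,
    funext (ιMulti_family_eq_ιMulti v), Set.range_const]

theorem exteriorPower_eq_bot_of_lt {n : ℕ} {v : Fin t → M}
    (hv : Submodule.span R (Set.range v) = ⊤) (hn : t < n) : ⋀[R]^n M = ⊥ := by
  have : IsEmpty (Set.powersetCard (Fin t) n) := ⟨fun s => absurd (s.1.card_le_univ)
    (by rw [s.2, Fintype.card_fin]; exact hn.not_ge)⟩
  rw [← exteriorPower.ιMulti_family_span_fixedDegree_of_span R hv, Set.range_eq_empty,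
    Submodule.span_empty]

variable (b : Module.Basis (Fin t) R M)

theorem exteriorAlgebra_basis_univ :
    b.ExteriorAlgebra Finset.univ = ExteriorAlgebra.ιMulti R t b := by
  rw [← ιMulti_family_eq_ιMulti b (ofCard (s := Finset.univ) (by simp))]
  exact ExteriorAlgebra.basis_apply_ofCard b (Finset.card_fin t)

theorem exteriorAlgebra_basis_mul_compl_eq_zero {S T : Finset (Fin t)} (h : ¬ T ⊆ S) :
    b.ExteriorAlgebra T * b.ExteriorAlgebra Sᶜ = 0 :=
  ExteriorAlgebra.basis_mul_of_not_disjoint b (ofCard (s := T) rfl) (ofCard (s := Sᶜ) rfl)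
    (mt disjoint_compl_right_iff.1 h)

theorem exists_exteriorAlgebra_basis_mul_compl (S : Finset (Fin t)) :
    ∃ u : ℤˣ, b.ExteriorAlgebra S * b.ExteriorAlgebra Sᶜ = u • ExteriorAlgebra.ιMulti R t b := by
  have hd : Disjoint (ofCard (s := S) rfl).val (ofCard (s := Sᶜ) rfl).val :=
    disjoint_compl_right (a := S)
  have huniv : (disjUnion hd).val = Finset.univ := by simp
  exact ⟨Equiv.Perm.sign (permOfDisjoint hd),
    (ExteriorAlgebra.basis_mul_of_disjoint b _ _ hd).trans
      (by rw [huniv, exteriorAlgebra_basis_univ])⟩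

theorem exists_mul_eq_smul_ιMulti {z : ExteriorAlgebra R M} (hz : z ≠ 0) :
    ∃ w, ∃ r : R, r ≠ 0 ∧ z * w = r • ExteriorAlgebra.ιMulti R t b := by
  classical
  let E := b.ExteriorAlgebra
  have hsupp : (E.repr z).support.Nonempty :=
    Finsupp.support_nonempty_iff.2 (E.repr.map_ne_zero_iff.2 hz)
  obtain ⟨S, hS, hmin⟩ := Finset.exists_min_image _ Finset.card hsupp
  obtain ⟨u, hu⟩ := exists_exteriorAlgebra_basis_mul_compl b S
  -- Since `S` is smallest, `E Sᶜ` kills every other term of `z`.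
  have hprod : z * E Sᶜ = E.repr z S • (E S * E Sᶜ) := by
    conv_lhs => rw [← E.linearCombination_repr z, Finsupp.linearCombination_apply, Finsupp.sum]
    rw [Finset.sum_mul, Finset.sum_eq_single_of_mem S hS, smul_mul_assoc]
    intro T hT hTS
    rw [smul_mul_assoc, exteriorAlgebra_basis_mul_compl_eq_zero b fun hle =>
      hTS (Finset.eq_of_subset_of_card_le hle (hmin T hT)), smul_zero]
  refine ⟨u⁻¹ • E Sᶜ, E.repr z S, Finsupp.mem_support_iff.1 hS, ?_⟩
  rw [mul_smul_comm, hprod, hu, smul_comm, inv_smul_smul]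

theorem exteriorAlgebra_injective_iff_of_basis {B : Type*} [Ring B] [Algebra R B]
    (f : ExteriorAlgebra R M →ₐ[R] B) :
    Function.Injective f ↔ ∀ r : R, r • f (ExteriorAlgebra.ιMulti R t b) = 0 → r = 0 := by
  refine ⟨fun hf r hr => ?_, fun hf => (injective_iff_map_eq_zero f).2 fun z hz => ?_⟩
  · rw [← map_smul, map_eq_zero_iff f hf, ← exteriorAlgebra_basis_univ] at hr
    simpa using congrArg (fun z => b.ExteriorAlgebra.repr z Finset.univ) hr
  · by_contra hne
    obtain ⟨w, r, hr, hzw⟩ := exists_mul_eq_smul_ιMulti b hne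
    exact hr (hf r (by rw [← map_smul, ← hzw, map_mul, hz, zero_mul]))

end ExteriorAlgebra

section EvenPart

open DirectSum

namespace SuperRing

variable {A : Type*} [Ring A] (𝒜 : ZMod 2 → AddSubgroup A) [GradedRing 𝒜]

theorem odd_mul_odd_mem {x y : A} (hx : x ∈ 𝒜 1) (hy : y ∈ 𝒜 1) : x * y ∈ 𝒜 0 := by
  simpa only [show (1 : ZMod 2) + 1 = 0 by decide] using SetLike.mul_mem_graded hx hy

theorem decompose_mul_one (a b : A) :
    (decompose 𝒜 (a * b) 1 : A) = decompose 𝒜 a 0 * (decompose 𝒜 b 1 : A) +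
      decompose 𝒜 a 1 * (decompose 𝒜 b 0 : A) := by
  obtain ⟨a₀, ha₀, a₁, ha₁, rfl⟩ := exists_even_add_odd 𝒜 a
  obtain ⟨b₀, hb₀, b₁, hb₁, rfl⟩ := exists_even_add_odd 𝒜 b
  have h₀₁ : a₀ * b₁ ∈ 𝒜 1 := by simpa only [zero_add] using SetLike.mul_mem_graded ha₀ hb₁
  have h₁₀ : a₁ * b₀ ∈ 𝒜 1 := by simpa only [add_zero] using SetLike.mul_mem_graded ha₁ hb₀
  have h₀₀ : a₀ * b₀ ∈ 𝒜 0 := by simpa only [add_zero] using SetLike.mul_mem_graded ha₀ hb₀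
  simp only [mul_add, add_mul, decompose_add, DirectSum.add_apply, AddSubgroup.coe_add,
    decompose_of_mem_same 𝒜 ha₀, decompose_of_mem_same 𝒜 hb₀, decompose_of_mem_same 𝒜 ha₁,
    decompose_of_mem_same 𝒜 hb₁, decompose_of_mem_ne 𝒜 ha₀ zero_ne_one,
    decompose_of_mem_ne 𝒜 hb₀ zero_ne_one, decompose_of_mem_ne 𝒜 ha₁ one_ne_zero,
    decompose_of_mem_ne 𝒜 hb₁ one_ne_zero, decompose_of_mem_ne 𝒜 h₀₀ zero_ne_one,
    decompose_of_mem_ne 𝒜 (odd_mul_odd_mem 𝒜 ha₁ hb₁) zero_ne_one,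
    decompose_of_mem_same 𝒜 h₀₁, decompose_of_mem_same 𝒜 h₁₀, add_zero, zero_add]
  rw [add_comm]

variable [IsSuperCommutative 𝒜]

instance instAlgebraEven : Algebra (𝒜 0) A where
  smul r a := r * a
  algebraMap := SubringClass.subtype (SetLike.GradeZero.subring 𝒜)
  commutes' r a := even_comm 𝒜 r.2 a
  smul_def' _ _ := rfl

/-- The component of parity `i`, as a module over the even part. -/
def gradedPart (i : ZMod 2) : Submodule (𝒜 0) A where
  carrier := 𝒜 i
  add_mem' := add_mem
  zero_mem' := zero_mem _
  smul_mem' r a ha := by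
    change (r : A) * a ∈ 𝒜 i
    simpa only [zero_add] using SetLike.mul_mem_graded r.2 ha

theorem decompose_mem_of_mem_span {i : ZMod 2} {M : Submodule (𝒜 0) A}
    (hM : M ≤ gradedPart 𝒜 i) {a : A} (ha : a ∈ Ideal.span (M : Set A)) :
    (decompose 𝒜 a i : A) ∈ M := by
  induction ha using Submodule.closure_induction with
  | zero => simp only [decompose_zero, DirectSum.zero_apply, ZeroMemClass.coe_zero, zero_mem]
  | add a b _ _ ha hb =>
    rw [decompose_add, DirectSum.add_apply, AddSubgroup.coe_add]
    exact add_mem ha hb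
  | smul_mem c y hy =>
    have hcy : (decompose 𝒜 (c * y) i : A) = decompose 𝒜 c 0 * y := by
      have h := coe_decompose_mul_add_of_right_mem 𝒜 (a := c) (i := 0) (hM hy)
      rwa [zero_add] at h
    rw [smul_eq_mul, hcy]
    exact M.smul_mem (decompose 𝒜 c 0) hy

theorem mem_span_iff_mem {i : ZMod 2} {M : Submodule (𝒜 0) A} (hM : M ≤ gradedPart 𝒜 i)
    {y : A} (hy : y ∈ 𝒜 i) : y ∈ Ideal.span (M : Set A) ↔ y ∈ M := by
  refine ⟨fun h => ?_, fun h => Ideal.subset_span h⟩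
  simpa only [decompose_of_mem_same 𝒜 hy] using decompose_mem_of_mem_span 𝒜 hM h

variable [IsNoetherianSuperRing 𝒜]

instance isNoetherian_gradedPart (i : ZMod 2) : IsNoetherian (𝒜 0) (gradedPart 𝒜 i) := by
  have := IsNoetherianSuperRing.wellFoundedGT (𝒜 := 𝒜)
  let inA (M : Submodule (𝒜 0) (gradedPart 𝒜 i)) := M.map (gradedPart 𝒜 i).subtype
  have inA_le (M) : inA M ≤ gradedPart 𝒜 i := Submodule.map_subtype_le _ M
  let superIdeal (M : Submodule (𝒜 0) (gradedPart 𝒜 i)) : HomogeneousIdeal 𝒜 :=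
    ⟨Ideal.span (inA M : Set A), Ideal.homogeneous_span 𝒜 _ fun x hx => ⟨i, inA_le M hx⟩⟩
  have mem_superIdeal (M) (y : gradedPart 𝒜 i) : (y : A) ∈ (superIdeal M).toIdeal ↔ y ∈ M :=
    (mem_span_iff_mem 𝒜 (inA_le M) y.2).trans
      ((gradedPart 𝒜 i).injective_subtype.mem_set_image)
  have mono : Monotone superIdeal := fun M M' h =>
    Ideal.span_mono (Submodule.map_mono (f := (gradedPart 𝒜 i).subtype) h)
  have injective : Function.Injective superIdeal := fun M M' h => by
    ext y
    rw [← mem_superIdeal, h, mem_superIdeal]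
  exact isNoetherian_iff'.2 (mono.strictMono_of_injective injective).wellFoundedGT

instance isNoetherianRing_even : IsNoetherianRing (𝒜 0) :=
  let e : gradedPart 𝒜 0 ≃ₗ[𝒜 0] 𝒜 0 :=
    { toFun := fun y => ⟨y, y.2⟩
      invFun := fun y => ⟨y, y.2⟩
      map_add' := fun _ _ => rfl
      map_smul' := fun _ _ => rfl
      left_inv := fun _ => rfl
      right_inv := fun _ => rfl }
  isNoetherian_of_linearEquiv e

end SuperRing

end EvenPart

section OddIdealPowers

open Pointwise

namespace SuperRing

variable {A : Type*} [Ring A] (𝒜 : ZMod 2 → AddSubgroup A) [GradedRing 𝒜] [IsSuperCommutative 𝒜]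

/-- The algebra map from the exterior algebra of the odd part, over the even part, that extends the
inclusion of the odd part. -/
noncomputable def exteriorToSelf : ExteriorAlgebra (𝒜 0) (gradedPart 𝒜 1) →ₐ[𝒜 0] A :=
  ExteriorAlgebra.lift (𝒜 0) ⟨(gradedPart 𝒜 1).subtype,
    fun y => IsSuperCommutative.odd_mul_self (𝒜 := 𝒜) (y : A) y.2⟩

theorem exteriorToSelf_comp_ι :
    (exteriorToSelf 𝒜).toLinearMap ∘ₗ ExteriorAlgebra.ι (𝒜 0) = (gradedPart 𝒜 1).subtype :=
  ExteriorAlgebra.ι_comp_lift (𝒜 0) _ _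

theorem exteriorToSelf_ιMulti {n : ℕ} (y : Fin n → gradedPart 𝒜 1) :
    exteriorToSelf 𝒜 (ExteriorAlgebra.ιMulti (𝒜 0) n y) = (List.ofFn fun i => (y i : A)).prod := by
  rw [ExteriorAlgebra.ιMulti_apply, map_list_prod, List.map_ofFn]
  exact congrArg (fun f => (List.ofFn f).prod)
    (funext fun i => LinearMap.congr_fun (exteriorToSelf_comp_ι 𝒜) (y i))

theorem gradedPart_one_pow_eq_map (n : ℕ) :
    gradedPart 𝒜 1 ^ n =
      (⋀[𝒜 0]^n (gradedPart 𝒜 1)).map (exteriorToSelf 𝒜).toLinearMap := by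
  rw [ExteriorAlgebra.exteriorPower, Submodule.map_pow, ← LinearMap.range_comp,
    exteriorToSelf_comp_ι, Submodule.range_subtype]

theorem prod_mem_gradedPart_one_pow {n : ℕ} (y : Fin n → gradedPart 𝒜 1) :
    (List.ofFn fun i => (y i : A)).prod ∈ gradedPart 𝒜 1 ^ n := by
  rw [gradedPart_one_pow_eq_map, ← exteriorToSelf_ιMulti]
  exact Submodule.mem_map_of_mem (ExteriorAlgebra.ιMulti_range _ _ ⟨y, rfl⟩)

theorem gradedPart_one_pow_eq_span {t : ℕ} {x : Fin t → gradedPart 𝒜 1}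
    (hx : Submodule.span (𝒜 0) (Set.range x) = ⊤) :
    gradedPart 𝒜 1 ^ t = Submodule.span (𝒜 0) {(List.ofFn fun i => (x i : A)).prod} := by
  rw [gradedPart_one_pow_eq_map, exteriorPower_eq_span_ιMulti hx, Submodule.map_span,
    Set.image_singleton, AlgHom.toLinearMap_apply, exteriorToSelf_ιMulti]

theorem gradedPart_one_pow_eq_bot_of_lt {t n : ℕ} {x : Fin t → gradedPart 𝒜 1}
    (hx : Submodule.span (𝒜 0) (Set.range x) = ⊤) (hn : t < n) : gradedPart 𝒜 1 ^ n = ⊥ := by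
  rw [gradedPart_one_pow_eq_map, exteriorPower_eq_bot_of_lt hx hn, Submodule.map_bot]

theorem oddIdeal_pow_le_span (n : ℕ) :
    oddIdeal 𝒜 ^ n ≤ Ideal.span ((gradedPart 𝒜 1 ^ n : Submodule (𝒜 0) A) : Set A) := by
  have oddIdeal_pow_eq : oddIdeal 𝒜 ^ n = Ideal.span ((𝒜 1 : Set A) ^ n) := by
    induction n with
    | zero =>
      rw [Submodule.pow_zero, Ideal.one_eq_top, pow_zero, ← Set.singleton_one,
        Ideal.span_singleton_one]
    | succ n ih =>
      have : (Ideal.span ((𝒜 1 : Set A) ^ n)).IsTwoSided := ih ▸ inferInstance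
      rw [Submodule.pow_succ, ih, pow_succ]
      exact Ideal.span_mul_span' _ _
  rw [oddIdeal_pow_eq]
  exact Ideal.span_mono (Submodule.pow_subset_pow (gradedPart 𝒜 1))

theorem oddIdeal_pow_eq_bot {t : ℕ} {x : Fin t → gradedPart 𝒜 1}
    (hx : Submodule.span (𝒜 0) (Set.range x) = ⊤) : oddIdeal 𝒜 ^ (t + 1) = ⊥ := by
  refine le_bot_iff.1 ((oddIdeal_pow_le_span 𝒜 (t + 1)).trans ?_)
  rw [gradedPart_one_pow_eq_bot_of_lt 𝒜 hx t.lt_succ_self]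
  exact Ideal.span_le.2 fun _ h => h

theorem exists_oddIdeal_pow_eq_bot [IsNoetherianSuperRing 𝒜] : ∃ n, oddIdeal 𝒜 ^ n = ⊥ := by
  obtain ⟨t, x, hx⟩ := Module.Finite.exists_fin (R := 𝒜 0) (M := gradedPart 𝒜 1)
  exact ⟨t + 1, oddIdeal_pow_eq_bot 𝒜 hx⟩

end SuperRing

end OddIdealPowers

section Bar

open DirectSum IsLocalRing

namespace SuperRing

variable {A : Type*} [Ring A] (𝒜 : ZMod 2 → AddSubgroup A) [GradedRing 𝒜] [IsSuperCommutative 𝒜]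

/-- The map from the even part to the quotient by a two-sided ideal. -/
def evenToQuotient (J : Ideal A) [J.IsTwoSided] : 𝒜 0 →+* A ⧸ J :=
  (Ideal.Quotient.mk J).comp (algebraMap (𝒜 0) A)

theorem evenToQuotient_eq_zero_iff {J : Ideal A} [J.IsTwoSided] {r : 𝒜 0} :
    evenToQuotient 𝒜 J r = 0 ↔ (r : A) ∈ J :=
  Ideal.Quotient.eq_zero_iff_mem

theorem evenToQuotient_surjective {J : Ideal A} [J.IsTwoSided] (hJ : oddIdeal 𝒜 ≤ J) :
    Function.Surjective (evenToQuotient 𝒜 J) := by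
  intro c
  obtain ⟨a, rfl⟩ := Ideal.Quotient.mk_surjective c
  obtain ⟨x, hx, y, hy, rfl⟩ := exists_even_add_odd 𝒜 a
  refine ⟨⟨x, hx⟩, (Ideal.Quotient.eq.2 ?_).symm⟩
  change x + y - x ∈ J
  rw [add_sub_cancel_left]
  exact hJ (Ideal.subset_span hy)

/-- The quotient map from the even part onto `A / I`, where `I` is the ideal generated by the odd
elements. -/
abbrev evenToBar : 𝒜 0 →+* A ⧸ oddIdeal 𝒜 := evenToQuotient 𝒜 (oddIdeal 𝒜)

theorem evenToBar_surjective : Function.Surjective (evenToBar 𝒜) :=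
  evenToQuotient_surjective 𝒜 le_rfl

theorem ker_evenToBar_le_nilradical [IsNoetherianSuperRing 𝒜] :
    RingHom.ker (evenToBar 𝒜) ≤ nilradical (𝒜 0) := by
  intro r hr
  obtain ⟨n, hn⟩ := exists_oddIdeal_pow_eq_bot 𝒜
  have hrn : (r : A) ^ n ∈ oddIdeal 𝒜 ^ n :=
    Ideal.pow_mem_pow ((evenToQuotient_eq_zero_iff 𝒜).1 hr) n
  rw [hn, Ideal.mem_bot] at hrn
  exact ⟨n, Subtype.ext hrn⟩

theorem ringKrullDim_even_eq_bar [IsNoetherianSuperRing 𝒜] :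
    ringKrullDim (𝒜 0) = ringKrullDim (A ⧸ oddIdeal 𝒜) := by
  rw [← ringKrullDim_quotient_eq_of_le_nilradical (ker_evenToBar_le_nilradical 𝒜)]
  exact ringKrullDim_eq_of_ringEquiv
    (RingHom.quotientKerEquivOfSurjective (evenToBar_surjective 𝒜))

instance isNoetherianRing_bar [IsNoetherianSuperRing 𝒜] : IsNoetherianRing (A ⧸ oddIdeal 𝒜) :=
  isNoetherianRing_of_surjective _ _ _ (evenToBar_surjective 𝒜)

/-- The super-ideal of `A` corresponding to an ideal of `A / I`, where `I` is the ideal generated by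
the odd elements. -/
def superIdealOfBar (J : Ideal (A ⧸ oddIdeal 𝒜)) : HomogeneousIdeal 𝒜 where
  toSubmodule := J.comap (Ideal.Quotient.mk (oddIdeal 𝒜))
  is_homogeneous' i a ha := by
    have odd_mem : (decompose 𝒜 a 1 : A) ∈ J.comap (Ideal.Quotient.mk (oddIdeal 𝒜)) := by
      have h : (decompose 𝒜 a 1 : A) ∈ oddIdeal 𝒜 := Ideal.subset_span (SetLike.coe_mem _)
      rw [Ideal.mem_comap, Ideal.Quotient.eq_zero_iff_mem.2 h]
      exact J.zero_mem
    fin_cases i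
    · change (decompose 𝒜 a 0 : A) ∈ J.comap (Ideal.Quotient.mk (oddIdeal 𝒜))
      rw [eq_sub_of_add_eq (eq_even_add_odd 𝒜 a).symm]
      exact sub_mem ha odd_mem
    · exact odd_mem

theorem mem_superIdealOfBar {J : Ideal (A ⧸ oddIdeal 𝒜)} {a : A} :
    a ∈ (superIdealOfBar 𝒜 J).toIdeal ↔ Ideal.Quotient.mk (oddIdeal 𝒜) a ∈ J := Iff.rfl

theorem superIdealOfBar_injective : Function.Injective (superIdealOfBar 𝒜) := fun _ _ h =>
  Ideal.comap_injective_of_surjective _ Ideal.Quotient.mk_surjective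
    (congrArg HomogeneousIdeal.toIdeal h)

theorem oddIdeal_le_superIdealOfBar (J : Ideal (A ⧸ oddIdeal 𝒜)) :
    oddIdeal 𝒜 ≤ (superIdealOfBar 𝒜 J).toIdeal := by
  intro a ha
  rw [mem_superIdealOfBar, Ideal.Quotient.eq_zero_iff_mem.2 ha]
  exact J.zero_mem

theorem isMaximalSuperIdeal_superIdealOfBar_iff {J : Ideal (A ⧸ oddIdeal 𝒜)} :
    IsMaximalSuperIdeal 𝒜 (superIdealOfBar 𝒜 J) ↔ J.IsMaximal := by
  let e₁ := RingHom.quotientKerEquivOfSurjective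
    (evenToQuotient_surjective 𝒜 (oddIdeal_le_superIdealOfBar 𝒜 J))
  let e₂ := RingHom.quotientKerEquivOfSurjective
    (f := (Ideal.Quotient.mk J).comp (evenToBar 𝒜))
    (Ideal.Quotient.mk_surjective.comp (evenToBar_surjective 𝒜))
  have ker_eq : RingHom.ker (evenToQuotient 𝒜 (superIdealOfBar 𝒜 J).toIdeal) =
      RingHom.ker ((Ideal.Quotient.mk J).comp (evenToBar 𝒜)) := by
    ext r
    rw [RingHom.mem_ker, evenToQuotient_eq_zero_iff, RingHom.mem_ker, RingHom.comp_apply,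
      Ideal.Quotient.eq_zero_iff_mem]
    rfl
  let e := e₁.symm.trans ((Ideal.quotEquivOfEq ker_eq).trans e₂)
  rw [Ideal.Quotient.maximal_ideal_iff_isField_quotient]
  exact ⟨fun h => e.symm.toMulEquiv.isField h, fun h => e.toMulEquiv.isField h⟩

theorem oddIdeal_le_of_isMaximalSuperIdeal {P : HomogeneousIdeal 𝒜}
    (hP : IsMaximalSuperIdeal 𝒜 P) : oddIdeal 𝒜 ≤ P.toIdeal := by
  have : IsDomain (A ⧸ P.toIdeal) := hP.isDomain
  refine Ideal.span_le.2 fun y hy => Ideal.Quotient.eq_zero_iff_mem.1 (mul_self_eq_zero.1 ?_)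
  rw [← map_mul, IsSuperCommutative.odd_mul_self (𝒜 := 𝒜) y hy, map_zero]

theorem exists_eq_superIdealOfBar {P : HomogeneousIdeal 𝒜} (hP : oddIdeal 𝒜 ≤ P.toIdeal) :
    ∃ J, P = superIdealOfBar 𝒜 J := by
  refine ⟨P.toIdeal.map (Ideal.Quotient.mk (oddIdeal 𝒜)), HomogeneousIdeal.ext ?_⟩
  change P.toIdeal = (P.toIdeal.map _).comap _
  rw [Ideal.comap_map_of_surjective _ Ideal.Quotient.mk_surjective, ← RingHom.ker_eq_comap_bot,
    Ideal.mk_ker, sup_eq_left.2 hP]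

variable [IsLocalSuperRing 𝒜]

theorem isMaximal_maximalSuperIdeal : IsMaximalSuperIdeal 𝒜 (maximalSuperIdeal 𝒜) :=
  (IsLocalSuperRing.existsUnique_maximal (𝒜 := 𝒜)).choose_spec.1

theorem oddIdeal_le_maximalSuperIdeal : oddIdeal 𝒜 ≤ (maximalSuperIdeal 𝒜).toIdeal :=
  oddIdeal_le_of_isMaximalSuperIdeal 𝒜 (isMaximal_maximalSuperIdeal 𝒜)

instance isLocalRing_bar : IsLocalRing (A ⧸ oddIdeal 𝒜) := by
  obtain ⟨J, hJ⟩ := exists_eq_superIdealOfBar 𝒜 (oddIdeal_le_maximalSuperIdeal 𝒜)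
  have J_isMaximal := isMaximal_maximalSuperIdeal 𝒜
  rw [hJ, isMaximalSuperIdeal_superIdealOfBar_iff] at J_isMaximal
  refine IsLocalRing.of_unique_max_ideal ⟨J, J_isMaximal, fun J' hJ' => ?_⟩
  refine superIdealOfBar_injective 𝒜 (hJ ▸ ?_)
  exact (IsLocalSuperRing.existsUnique_maximal (𝒜 := 𝒜)).choose_spec.2 _
    ((isMaximalSuperIdeal_superIdealOfBar_iff 𝒜).2 hJ')

theorem superIdealOfBar_maximalIdeal :
    superIdealOfBar 𝒜 (maximalIdeal (A ⧸ oddIdeal 𝒜)) = maximalSuperIdeal 𝒜 :=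
  (IsLocalSuperRing.existsUnique_maximal (𝒜 := 𝒜)).choose_spec.2 _
    ((isMaximalSuperIdeal_superIdealOfBar_iff 𝒜).2 (maximalIdeal.isMaximal _))

theorem evenToBar_mem_maximalIdeal_iff {r : 𝒜 0} :
    evenToBar 𝒜 r ∈ maximalIdeal (A ⧸ oddIdeal 𝒜) ↔ (r : A) ∈ (maximalSuperIdeal 𝒜).toIdeal := by
  rw [← superIdealOfBar_maximalIdeal]
  rfl

variable [IsNoetherianSuperRing 𝒜]

instance isLocalHom_evenToBar : IsLocalHom (evenToBar 𝒜) where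
  map_nonunit r hr := by
    obtain ⟨c, hc⟩ := hr.exists_right_inv
    obtain ⟨s, rfl⟩ := evenToBar_surjective 𝒜 c
    have isNilpotent_sub : IsNilpotent (r * s - 1) := ker_evenToBar_le_nilradical 𝒜 <| by
      rw [RingHom.mem_ker, map_sub, map_mul, hc, map_one, sub_self]
    have isUnit_mul := isNilpotent_sub.isUnit_add_one
    rw [sub_add_cancel] at isUnit_mul
    exact isUnit_of_mul_isUnit_left isUnit_mul

instance isLocalRing_even : IsLocalRing (𝒜 0) := RingHom.domain_isLocalRing (evenToBar 𝒜)

theorem mem_maximalIdeal_even_iff {r : 𝒜 0} :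
    r ∈ maximalIdeal (𝒜 0) ↔ (r : A) ∈ (maximalSuperIdeal 𝒜).toIdeal := by
  rw [← evenToBar_mem_maximalIdeal_iff, mem_maximalIdeal, mem_maximalIdeal, mem_nonunits_iff,
    mem_nonunits_iff, isUnit_map_iff]

theorem map_evenToBar_maximalIdeal :
    (maximalIdeal (𝒜 0)).map (evenToBar 𝒜) = maximalIdeal (A ⧸ oddIdeal 𝒜) :=
  map_maximalIdeal_of_surjective _ (evenToBar_surjective 𝒜)

end SuperRing

end Bar

section DegreeOneClass

namespace SuperRing

variable {A : Type*} [Ring A] (𝒜 : ZMod 2 → AddSubgroup A) [GradedRing 𝒜] [IsSuperCommutative 𝒜]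

/-- The map sending an element of an `𝒜 0`-submodule of `J` to its class in `J / J ^ 2`. -/
def degreeOneClass (J : Ideal A) [J.IsTwoSided] {N : Submodule (𝒜 0) A}
    (hN : N ≤ J.restrictScalars (𝒜 0)) : N →ₛₗ[evenToQuotient 𝒜 J] GrPiece J 1 where
  toFun y := GrPiece.mk J 1 ⟨y, (Submodule.pow_one J).ge (hN y.2)⟩
  map_add' _ _ := rfl
  map_smul' _ _ := rfl

theorem degreeOneClass_eq_zero_iff {J : Ideal A} [J.IsTwoSided] {N : Submodule (𝒜 0) A}
    {hN : N ≤ J.restrictScalars (𝒜 0)} {y : N} :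
    degreeOneClass 𝒜 J hN y = 0 ↔ (y : A) ∈ J ^ 2 := by
  refine (GrPiece.mk_eq_mk_iff (y := 0)).trans ?_
  rw [ZeroMemClass.coe_zero, sub_zero]

end SuperRing

end DegreeOneClass

section ExteriorToGr

theorem prod_ofFn_succ_last {M : Type*} [Monoid M] {n : ℕ} (f : Fin (n + 1) → M) :
    (List.ofFn f).prod = (List.ofFn fun i => f i.castSucc).prod * f (Fin.last n) := by
  rw [List.ofFn_succ', List.prod_concat]

namespace SuperRing

variable {A : Type*} [Ring A] (𝒜 : ZMod 2 → AddSubgroup A) [GradedRing 𝒜] [IsSuperCommutative 𝒜]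

theorem gradedPart_one_le_oddIdeal : gradedPart 𝒜 1 ≤ (oddIdeal 𝒜).restrictScalars (𝒜 0) :=
  fun _ hy => Ideal.subset_span hy

/-- The class of an odd element in `I / I ^ 2`, for `I` the ideal generated by the odd elements. -/
abbrev oddClass : gradedPart 𝒜 1 →ₛₗ[evenToBar 𝒜] GrPiece (oddIdeal 𝒜) 1 :=
  degreeOneClass 𝒜 (oddIdeal 𝒜) (gradedPart_one_le_oddIdeal 𝒜)

theorem oddClass_surjective : Function.Surjective (oddClass 𝒜) := by
  intro v
  obtain ⟨x, rfl⟩ := GrPiece.mk_surjective 1 v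
  obtain ⟨y, hy, hxy⟩ := exists_odd_sub_mem 𝒜 ((Submodule.pow_one (oddIdeal 𝒜)).le x.2)
  exact ⟨⟨y, hy⟩, (GrPiece.mk_eq_mk_iff.2 hxy).symm⟩

theorem exteriorToGr_ι (v : GrPiece (oddIdeal 𝒜) 1) :
    exteriorToGr 𝒜 (ExteriorAlgebra.ι (A ⧸ oddIdeal 𝒜) v) =
      DirectSum.of (GrPiece (oddIdeal 𝒜)) 1 v :=
  ExteriorAlgebra.lift_ι_apply _ _ _ v

theorem of_mem_range_exteriorToGr (n : ℕ) (v : GrPiece (oddIdeal 𝒜) n) :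
    DirectSum.of (GrPiece (oddIdeal 𝒜)) n v ∈ (exteriorToGr 𝒜).range := by
  obtain ⟨⟨a, ha⟩, rfl⟩ := GrPiece.mk_surjective n v
  induction n generalizing a with
  | zero => exact (exteriorToGr 𝒜).range.algebraMap_mem (Ideal.Quotient.mk (oddIdeal 𝒜) a)
  | succ n ih =>
    have ha' : a ∈ oddIdeal 𝒜 ^ n • oddIdeal 𝒜 := (Submodule.pow_succ (M := oddIdeal 𝒜)).le ha
    induction ha' using Submodule.smul_induction_on' with
    | smul b hb c hc =>
      have of_c_mem : DirectSum.of (GrPiece (oddIdeal 𝒜)) 1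
          (GrPiece.mk (oddIdeal 𝒜) 1 ⟨c, (Submodule.pow_one (oddIdeal 𝒜)).ge hc⟩) ∈
          (exteriorToGr 𝒜).range := ⟨_, exteriorToGr_ι 𝒜 _⟩
      have of_mul_mem := mul_mem (ih b hb) of_c_mem
      rwa [DirectSum.of_mul_of] at of_mul_mem
    | add b hb c hc of_b_mem of_c_mem =>
      rw [smul_eq_mul, ← Submodule.pow_succ] at hb hc
      have of_add_mem := add_mem (of_b_mem hb) (of_c_mem hc)
      rwa [← map_add] at of_add_mem

theorem exteriorToGr_surjective : Function.Surjective (exteriorToGr 𝒜) := by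
  intro z
  rw [← AlgHom.mem_range]
  induction z using DirectSum.induction_on with
  | zero => exact zero_mem _
  | of n v => exact of_mem_range_exteriorToGr 𝒜 n v
  | add v w hv hw => exact add_mem hv hw

theorem prod_mem_oddIdeal_pow {n : ℕ} (y : Fin n → gradedPart 𝒜 1) :
    (List.ofFn fun i => (y i : A)).prod ∈ oddIdeal 𝒜 ^ n := by
  induction n with
  | zero =>
    rw [Submodule.pow_zero, Ideal.one_eq_top]
    exact Submodule.mem_top
  | succ n ih =>
    rw [prod_ofFn_succ_last, Submodule.pow_succ]
    exact Ideal.mul_mem_mul (ih fun i => y i.castSucc)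
      (gradedPart_one_le_oddIdeal 𝒜 (y (Fin.last n)).2)

theorem prod_of_oddClass {n : ℕ} (y : Fin n → gradedPart 𝒜 1) :
    (List.ofFn fun i =>
      (DirectSum.of (GrPiece (oddIdeal 𝒜)) 1 (oddClass 𝒜 (y i)) : AssocGr (oddIdeal 𝒜))).prod =
      DirectSum.of (GrPiece (oddIdeal 𝒜)) n (GrPiece.mk (oddIdeal 𝒜) n
        ⟨(List.ofFn fun i => (y i : A)).prod, prod_mem_oddIdeal_pow 𝒜 y⟩) := by
  induction n with
  | zero => rfl
  | succ n ih =>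
    rw [prod_ofFn_succ_last (M := AssocGr (oddIdeal 𝒜)), ih fun i => y i.castSucc]
    refine (DirectSum.of_mul_of _ _).trans ?_
    exact congrArg (fun v => DirectSum.of (GrPiece (oddIdeal 𝒜)) (n + 1) (GrPiece.mk _ _ v))
      (Subtype.ext (prod_ofFn_succ_last fun i => (y i : A)).symm)

theorem exteriorToGr_ιMulti {n : ℕ} (y : Fin n → gradedPart 𝒜 1) :
    exteriorToGr 𝒜 (ExteriorAlgebra.ιMulti (A ⧸ oddIdeal 𝒜) n (oddClass 𝒜 ∘ y)) =
      DirectSum.of (GrPiece (oddIdeal 𝒜)) n (GrPiece.mk (oddIdeal 𝒜) n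
        ⟨(List.ofFn fun i => (y i : A)).prod, prod_mem_oddIdeal_pow 𝒜 y⟩) := by
  rw [ExteriorAlgebra.ιMulti_apply, map_list_prod, List.map_ofFn, ← prod_of_oddClass]
  exact congrArg (fun f => (List.ofFn f).prod) (funext fun i => exteriorToGr_ι 𝒜 _)

theorem smul_exteriorToGr_ιMulti_eq_zero_iff {n : ℕ} (y : Fin n → gradedPart 𝒜 1) (r : 𝒜 0) :
    evenToBar 𝒜 r • exteriorToGr 𝒜
        (ExteriorAlgebra.ιMulti (A ⧸ oddIdeal 𝒜) n (oddClass 𝒜 ∘ y)) = 0 ↔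
      (r : A) * (List.ofFn fun i => (y i : A)).prod ∈ oddIdeal 𝒜 ^ (n + 1) := by
  rw [exteriorToGr_ιMulti, ← DirectSum.lof_eq_of (A ⧸ oddIdeal 𝒜), ← map_smul,
    DirectSum.lof_eq_of, map_eq_zero_iff _ (DirectSum.of_injective n)]
  change GrPiece.mk (oddIdeal 𝒜) n
    ((r : A) • ⟨(List.ofFn fun i => (y i : A)).prod, prod_mem_oddIdeal_pow 𝒜 y⟩) = 0 ↔ _
  refine (GrPiece.mk_eq_mk_iff (y := 0)).trans ?_
  rw [ZeroMemClass.coe_zero, sub_zero]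
  rfl

end SuperRing

end ExteriorToGr

section RankComparison

theorem exists_addEquiv_of_ker_eq {N V W : Type*} [AddCommGroup N] [AddCommGroup V]
    [AddCommGroup W] {f : N →+ V} {g : N →+ W} (hf : Function.Surjective f)
    (hg : Function.Surjective g) (h : f.ker = g.ker) : ∃ e : V ≃+ W, ∀ n, e (f n) = g n := by
  let quotEquiv := QuotientAddGroup.quotientKerEquivOfSurjective f hf
  refine ⟨quotEquiv.symm.trans ((QuotientAddGroup.quotientAddEquivOfEq h).trans
    (QuotientAddGroup.quotientKerEquivOfSurjective g hg)), fun n => ?_⟩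
  have symm_apply : quotEquiv.symm (f n) = (n : N ⧸ f.ker) := quotEquiv.symm_apply_apply n
  rw [AddEquiv.trans_apply, symm_apply]
  rfl

theorem finrank_eq_of_surjective_of_ker_eq {R K K' N V W : Type*} [Ring R] [Ring K]
    [Ring K'] [AddCommGroup N] [AddCommGroup V] [AddCommGroup W] [Module R N] [Module K V]
    [Module K' W] {φ : R →+* K} {ψ : R →+* K'} (hφ : Function.Surjective φ)
    (hψ : Function.Surjective ψ) (hφψ : ∀ r, φ r = 0 ↔ ψ r = 0) {f : N →ₛₗ[φ] V}
    {g : N →ₛₗ[ψ] W} (hf : Function.Surjective f) (hg : Function.Surjective g)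
    (hfg : ∀ n, f n = 0 ↔ g n = 0) : Module.finrank K V = Module.finrank K' W := by
  obtain ⟨i, hi⟩ := exists_addEquiv_of_ker_eq (f := φ.toAddMonoidHom) (g := ψ.toAddMonoidHom)
    hφ hψ (AddSubgroup.ext hφψ)
  obtain ⟨j, hj⟩ := exists_addEquiv_of_ker_eq (f := f.toAddMonoidHom) (g := g.toAddMonoidHom)
    hf hg (AddSubgroup.ext hfg)
  have j_smul (k : K) (v : V) : j (k • v) = i k • j v := by
    obtain ⟨r, rfl⟩ := hφ k
    obtain ⟨n, rfl⟩ := hf v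
    calc j (φ r • f n) = j (f (r • n)) := by rw [map_smulₛₗ f]
      _ = g (r • n) := hj _
      _ = ψ r • g n := map_smulₛₗ g r n
      _ = i (φ r) • j (f n) := congrArg₂ (· • ·) (hi r).symm (hj n).symm
  have lift_rank_eq := lift_rank_eq_of_equiv_equiv i j i.bijective j_smul
  simpa only [Module.finrank, Cardinal.toNat_lift] using congrArg Cardinal.toNat lift_rank_eq

end RankComparison

section Cotangent

open DirectSum IsLocalRing

namespace SuperRing

variable {A : Type*} [Ring A] (𝒜 : ZMod 2 → AddSubgroup A) [GradedRing 𝒜]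

theorem decompose_zero_mem_sq_of_mem_oddIdeal {a : A} (ha : a ∈ oddIdeal 𝒜) :
    (decompose 𝒜 a 0 : A) ∈ oddIdeal 𝒜 ^ 2 := by
  induction ha using Submodule.closure_induction with
  | zero => simp only [decompose_zero, DirectSum.zero_apply, ZeroMemClass.coe_zero, zero_mem]
  | add a b _ _ ha hb =>
    rw [decompose_add, DirectSum.add_apply, AddSubgroup.coe_add]
    exact add_mem ha hb
  | smul_mem c y hy =>
    have decompose_mul : (decompose 𝒜 (c * y) 0 : A) = decompose 𝒜 c 1 * y := by
      have one_add_one : (1 : ZMod 2) + 1 = 0 := by decide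
      exact one_add_one ▸ coe_decompose_mul_add_of_right_mem 𝒜 (a := c) (i := 1) hy
    rw [smul_eq_mul, decompose_mul, Submodule.pow_succ, Submodule.pow_one]
    exact Ideal.mul_mem_mul (Ideal.subset_span (decompose 𝒜 c 1).2) (Ideal.subset_span hy)

variable [IsSuperCommutative 𝒜]

theorem cotangentComponent_eq_range {P : HomogeneousIdeal 𝒜} (hP : oddIdeal 𝒜 ≤ P.toIdeal)
    {i : ZMod 2} {N : Submodule (𝒜 0) A} (hN : N ≤ P.toIdeal.restrictScalars (𝒜 0))
    (mem_iff : ∀ a ∈ P.toIdeal, a ∈ 𝒜 i ↔ a ∈ N) :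
    haveI : RingHomSurjective (evenToQuotient 𝒜 P.toIdeal) := ⟨evenToQuotient_surjective 𝒜 hP⟩
    cotangentComponent 𝒜 P i = LinearMap.range (degreeOneClass 𝒜 P.toIdeal hN) := by
  have : RingHomSurjective (evenToQuotient 𝒜 P.toIdeal) := ⟨evenToQuotient_surjective 𝒜 hP⟩
  rw [cotangentComponent, ← Submodule.span_eq (LinearMap.range (degreeOneClass 𝒜 P.toIdeal hN))]
  congr 1
  ext v
  constructor
  · rintro ⟨x, hx, rfl⟩
    exact ⟨⟨x, (mem_iff x ((Submodule.pow_one P.toIdeal).le x.2)).1 hx⟩, rfl⟩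
  · rintro ⟨y, rfl⟩
    exact ⟨⟨y, (Submodule.pow_one P.toIdeal).ge (hN y.2)⟩, (mem_iff y (hN y.2)).2 y.2, rfl⟩

variable [IsLocalSuperRing 𝒜]

theorem mul_mem_maximalSuperIdeal_sq {a b : A} (ha : a ∈ (maximalSuperIdeal 𝒜).toIdeal)
    (hb : b ∈ (maximalSuperIdeal 𝒜).toIdeal) : a * b ∈ (maximalSuperIdeal 𝒜).toIdeal ^ 2 := by
  rw [Submodule.pow_succ, Submodule.pow_one]
  exact Ideal.mul_mem_mul ha hb

theorem oddIdeal_sq_le : oddIdeal 𝒜 ^ 2 ≤ (maximalSuperIdeal 𝒜).toIdeal ^ 2 := by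
  rw [Submodule.pow_succ, Submodule.pow_one]
  exact Ideal.mul_le.2 fun a ha b hb => mul_mem_maximalSuperIdeal_sq 𝒜
    (oddIdeal_le_maximalSuperIdeal 𝒜 ha) (oddIdeal_le_maximalSuperIdeal 𝒜 hb)

theorem gradedPart_one_le_maximalSuperIdeal :
    gradedPart 𝒜 1 ≤ (maximalSuperIdeal 𝒜).toIdeal.restrictScalars (𝒜 0) :=
  fun _ hy => oddIdeal_le_maximalSuperIdeal 𝒜 (Ideal.subset_span hy)

theorem mk_mem_maximalIdeal_sq {a : A} (ha : a ∈ (maximalSuperIdeal 𝒜).toIdeal ^ 2) :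
    Ideal.Quotient.mk (oddIdeal 𝒜) a ∈ maximalIdeal (A ⧸ oddIdeal 𝒜) ^ 2 := by
  rw [Submodule.pow_succ, Submodule.pow_one] at ha
  rw [← superIdealOfBar_maximalIdeal] at ha
  induction ha using Submodule.smul_induction_on' with
  | smul b hb c hc =>
    rw [smul_eq_mul, map_mul, sq]
    exact Ideal.mul_mem_mul hb hc
  | add b _ c _ hb hc => exact (map_add (Ideal.Quotient.mk (oddIdeal 𝒜)) b c) ▸ add_mem hb hc

/-- The map from the even elements of `𝔪` to the cotangent space of `A / I`, where `I` is the ideal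
generated by the odd elements. -/
noncomputable def evenToCotangentSpace :
    (gradedPart 𝒜 0 ⊓ (maximalSuperIdeal 𝒜).toIdeal.restrictScalars (𝒜 0) : Submodule (𝒜 0) A)
      →ₛₗ[(residue (A ⧸ oddIdeal 𝒜)).comp (evenToBar 𝒜)] CotangentSpace (A ⧸ oddIdeal 𝒜) where
  toFun y := (maximalIdeal (A ⧸ oddIdeal 𝒜)).toCotangent
    ⟨evenToBar 𝒜 ⟨y, y.2.1⟩, (evenToBar_mem_maximalIdeal_iff 𝒜).2 y.2.2⟩
  map_add' _ _ := rfl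
  map_smul' _ _ := rfl

theorem evenToCotangentSpace_surjective : Function.Surjective (evenToCotangentSpace 𝒜) := by
  intro v
  obtain ⟨⟨c, hc⟩, rfl⟩ := (maximalIdeal (A ⧸ oddIdeal 𝒜)).toCotangent_surjective v
  obtain ⟨r, rfl⟩ := evenToBar_surjective 𝒜 c
  exact ⟨⟨r, r.2, (evenToBar_mem_maximalIdeal_iff 𝒜).1 hc⟩, rfl⟩

variable [IsNoetherianSuperRing 𝒜]

theorem decompose_one_mem_of_mem_sq {a : A} (ha : a ∈ (maximalSuperIdeal 𝒜).toIdeal ^ 2) :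
    (decompose 𝒜 a 1 : A) ∈ maximalIdeal (𝒜 0) • gradedPart 𝒜 1 := by
  rw [Submodule.pow_succ, Submodule.pow_one] at ha
  induction ha using Submodule.smul_induction_on' with
  | smul b hb c hc =>
    have decompose_zero_mem {d : A} (hd : d ∈ (maximalSuperIdeal 𝒜).toIdeal) :
        decompose 𝒜 d 0 ∈ maximalIdeal (𝒜 0) :=
      (mem_maximalIdeal_even_iff 𝒜).2 ((maximalSuperIdeal 𝒜).isHomogeneous 0 hd)
    rw [smul_eq_mul, decompose_mul_one, ← even_comm 𝒜 (decompose 𝒜 c 0).2]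
    exact add_mem
      (Submodule.smul_mem_smul (N := gradedPart 𝒜 1) (decompose_zero_mem hb) (decompose 𝒜 c 1).2)
      (Submodule.smul_mem_smul (N := gradedPart 𝒜 1) (decompose_zero_mem hc) (decompose 𝒜 b 1).2)
  | add b _ c _ hb hc =>
    rw [decompose_add, DirectSum.add_apply, AddSubgroup.coe_add]
    exact add_mem hb hc

theorem odd_mem_sq_iff {y : A} (hy : y ∈ 𝒜 1) :
    y ∈ (maximalSuperIdeal 𝒜).toIdeal ^ 2 ↔ y ∈ maximalIdeal (𝒜 0) • gradedPart 𝒜 1 := by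
  refine ⟨fun h => ?_, fun h => ?_⟩
  · simpa only [decompose_of_mem_same 𝒜 hy] using decompose_one_mem_of_mem_sq 𝒜 h
  · exact Submodule.smul_induction_on h (fun r hr z hz => mul_mem_maximalSuperIdeal_sq 𝒜
      ((mem_maximalIdeal_even_iff 𝒜).1 hr) (gradedPart_one_le_maximalSuperIdeal 𝒜 hz))
      fun _ _ => add_mem

theorem even_mem_sq_iff {r : 𝒜 0} :
    (r : A) ∈ (maximalSuperIdeal 𝒜).toIdeal ^ 2 ↔
      evenToBar 𝒜 r ∈ maximalIdeal (A ⧸ oddIdeal 𝒜) ^ 2 := by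
  refine ⟨fun h => mk_mem_maximalIdeal_sq 𝒜 h, fun h => ?_⟩
  rw [← map_evenToBar_maximalIdeal, ← Ideal.map_pow,
    Ideal.mem_map_iff_of_surjective _ (evenToBar_surjective 𝒜)] at h
  obtain ⟨s, hs, hsr⟩ := h
  have s_mem : (s : A) ∈ (maximalSuperIdeal 𝒜).toIdeal ^ 2 := by
    rw [sq] at hs
    exact Submodule.mul_induction_on hs (fun a ha b hb => mul_mem_maximalSuperIdeal_sq 𝒜
      ((mem_maximalIdeal_even_iff 𝒜).1 ha) ((mem_maximalIdeal_even_iff 𝒜).1 hb)) fun _ _ => add_mem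
  have sub_mem_oddIdeal : ((r - s : 𝒜 0) : A) ∈ oddIdeal 𝒜 :=
    (evenToQuotient_eq_zero_iff 𝒜).1 (by rw [map_sub, hsr, sub_self])
  have sub_mem : ((r - s : 𝒜 0) : A) ∈ (maximalSuperIdeal 𝒜).toIdeal ^ 2 := by
    simpa only [decompose_of_mem_same 𝒜 (r - s).2] using
      oddIdeal_sq_le 𝒜 (decompose_zero_mem_sq_of_mem_oddIdeal 𝒜 sub_mem_oddIdeal)
  simpa only [AddSubgroup.coe_sub, sub_add_cancel] using add_mem sub_mem s_mem

theorem finrank_cotangentComponent_one :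
    Module.finrank (A ⧸ (maximalSuperIdeal 𝒜).toIdeal)
      (cotangentComponent 𝒜 (maximalSuperIdeal 𝒜) 1) = (gradedPart 𝒜 1).spanFinrank := by
  have evenToQuotient_surj := evenToQuotient_surjective 𝒜 (oddIdeal_le_maximalSuperIdeal 𝒜)
  have : RingHomSurjective (evenToQuotient 𝒜 (maximalSuperIdeal 𝒜).toIdeal) :=
    ⟨evenToQuotient_surj⟩
  rw [cotangentComponent_eq_range 𝒜 (oddIdeal_le_maximalSuperIdeal 𝒜)
      (gradedPart_one_le_maximalSuperIdeal 𝒜) fun _ _ => Iff.rfl,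
    IsLocalRing.spanFinrank_eq_finrank_quotient _ (Module.Finite.iff_fg.1 inferInstance)]
  let toQuotient : gradedPart 𝒜 1 →ₛₗ[Ideal.Quotient.mk (maximalIdeal (𝒜 0))]
      gradedPart 𝒜 1 ⧸ maximalIdeal (𝒜 0) • (⊤ : Submodule (𝒜 0) (gradedPart 𝒜 1)) :=
    { toFun := Submodule.Quotient.mk
      map_add' := fun _ _ => rfl
      map_smul' := fun _ _ => rfl }
  refine finrank_eq_of_surjective_of_ker_eq evenToQuotient_surj Ideal.Quotient.mk_surjective
    (fun r => ?_) (LinearMap.surjective_rangeRestrict _) (g := toQuotient)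
    (Submodule.Quotient.mk_surjective _) (fun y => ?_)
  · rw [evenToQuotient_eq_zero_iff, Ideal.Quotient.eq_zero_iff_mem, mem_maximalIdeal_even_iff]
  · refine (Subtype.ext_iff.trans (degreeOneClass_eq_zero_iff 𝒜)).trans ?_
    change _ ↔ (Submodule.Quotient.mk y : gradedPart 𝒜 1 ⧸ _) = 0
    rw [odd_mem_sq_iff 𝒜 y.2, Submodule.Quotient.mk_eq_zero, Submodule.mem_smul_top_iff]

theorem finrank_cotangentComponent_zero :
    Module.finrank (A ⧸ (maximalSuperIdeal 𝒜).toIdeal)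
      (cotangentComponent 𝒜 (maximalSuperIdeal 𝒜) 0) =
    Module.finrank (ResidueField (A ⧸ oddIdeal 𝒜)) (CotangentSpace (A ⧸ oddIdeal 𝒜)) := by
  have evenToQuotient_surj := evenToQuotient_surjective 𝒜 (oddIdeal_le_maximalSuperIdeal 𝒜)
  have : RingHomSurjective (evenToQuotient 𝒜 (maximalSuperIdeal 𝒜).toIdeal) :=
    ⟨evenToQuotient_surj⟩
  rw [cotangentComponent_eq_range 𝒜 (oddIdeal_le_maximalSuperIdeal 𝒜)
    (N := gradedPart 𝒜 0 ⊓ (maximalSuperIdeal 𝒜).toIdeal.restrictScalars (𝒜 0)) inf_le_right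
    fun a ha => (and_iff_left ha).symm]
  refine finrank_eq_of_surjective_of_ker_eq evenToQuotient_surj
    (residue_surjective.comp (evenToBar_surjective 𝒜)) (fun r => ?_)
    (LinearMap.surjective_rangeRestrict _) (evenToCotangentSpace_surjective 𝒜) (fun y => ?_)
  · rw [evenToQuotient_eq_zero_iff, RingHom.comp_apply, residue_eq_zero_iff,
      evenToBar_mem_maximalIdeal_iff]
  · refine (Subtype.ext_iff.trans (degreeOneClass_eq_zero_iff 𝒜)).trans ?_
    exact (even_mem_sq_iff 𝒜 (r := ⟨y, y.2.1⟩)).trans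
      (Ideal.toCotangent_eq_zero (maximalIdeal (A ⧸ oddIdeal 𝒜)) ⟨_, _⟩).symm

theorem isRegularLocalSuperRing_iff :
    IsRegularLocalSuperRing 𝒜 ↔ IsRegularLocalRing (A ⧸ oddIdeal 𝒜) ∧
      oddKrullDim 𝒜 = (gradedPart 𝒜 1).spanFinrank := by
  rw [IsRegularLocalSuperRing, IsRegularLocalRing.iff_finrank_cotangentSpace,
    finrank_cotangentComponent_zero, finrank_cotangentComponent_one, evenKrullDim,
    ringKrullDim_even_eq_bar, eq_comm (a := ringKrullDim _)]

end SuperRing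

end Cotangent

section OddParameters

namespace SuperRing

variable {A : Type*} [Ring A] (𝒜 : ZMod 2 → AddSubgroup A) [GradedRing 𝒜]

theorem mem_evenAnnihilator {a : A} {r : 𝒜 0} : r ∈ evenAnnihilator 𝒜 a ↔ (r : A) * a = 0 :=
  Iff.rfl

variable [IsSuperCommutative 𝒜]

theorem isSystemOfOddParameters_of_evenAnnihilator_le_nilradical {s : ℕ} {y : Fin s → 𝒜 1}
    (h : evenAnnihilator 𝒜 (List.ofFn fun i => (y i : A)).prod ≤ nilradical (𝒜 0)) :
    IsSystemOfOddParameters 𝒜 y :=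
  (ringKrullDim_quotient_eq_of_le_nilradical h).symm

theorem isSystemOfOddParameters_zero (y : Fin 0 → 𝒜 1) : IsSystemOfOddParameters 𝒜 y := by
  refine isSystemOfOddParameters_of_evenAnnihilator_le_nilradical 𝒜 fun r hr => ?_
  rw [mem_evenAnnihilator, List.ofFn_zero, List.prod_nil, mul_one] at hr
  exact (Subtype.ext hr : r = 0) ▸ zero_mem _

theorem isSystemOfOddParameters_of_evenAnnihilator_le {s t : ℕ} {y : Fin s → 𝒜 1}
    {z : Fin t → 𝒜 1} (hy : IsSystemOfOddParameters 𝒜 y)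
    (h : evenAnnihilator 𝒜 (List.ofFn fun i => (z i : A)).prod ≤
      evenAnnihilator 𝒜 (List.ofFn fun i => (y i : A)).prod) : IsSystemOfOddParameters 𝒜 z :=
  le_antisymm (hy.le.trans (ringKrullDim_le_of_surjective (Ideal.Quotient.factor h)
    (Ideal.Quotient.factor_surjective h))) (ringKrullDim_quotient_le _)

theorem prod_ne_zero_of_isSystemOfOddParameters [Nontrivial (𝒜 0)] {s : ℕ} {y : Fin s → 𝒜 1}
    (hy : IsSystemOfOddParameters 𝒜 y) : (List.ofFn fun i => (y i : A)).prod ≠ 0 := by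
  intro hprod
  have evenAnnihilator_eq_top : evenAnnihilator 𝒜 (List.ofFn fun i => (y i : A)).prod = ⊤ :=
    (Ideal.eq_top_iff_one _).2 ((mem_evenAnnihilator 𝒜).2 (by rw [hprod, mul_zero]))
  have := Ideal.Quotient.subsingleton_iff.2 evenAnnihilator_eq_top
  have dim_nonneg := ringKrullDim_nonneg_of_nontrivial (R := 𝒜 0)
  rw [hy, ringKrullDim_eq_bot_of_subsingleton] at dim_nonneg
  exact absurd dim_nonneg (by decide)

section Generators

variable {t : ℕ} {x : Fin t → gradedPart 𝒜 1} (hx : Submodule.span (𝒜 0) (Set.range x) = ⊤)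
include hx

theorem length_le_of_isSystemOfOddParameters [Nontrivial (𝒜 0)] {s : ℕ} {y : Fin s → 𝒜 1}
    (hy : IsSystemOfOddParameters 𝒜 y) : s ≤ t := by
  by_contra! hlt
  have prod_mem := prod_mem_gradedPart_one_pow 𝒜 y
  rw [gradedPart_one_pow_eq_bot_of_lt 𝒜 hx hlt] at prod_mem
  exact prod_ne_zero_of_isSystemOfOddParameters 𝒜 hy prod_mem

theorem evenAnnihilator_prod_le_of_generators (y : Fin t → 𝒜 1) :
    evenAnnihilator 𝒜 (List.ofFn fun i => (x i : A)).prod ≤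
      evenAnnihilator 𝒜 (List.ofFn fun i => (y i : A)).prod := by
  intro r hr
  have prod_mem := prod_mem_gradedPart_one_pow 𝒜 y
  rw [gradedPart_one_pow_eq_span 𝒜 hx, Submodule.mem_span_singleton] at prod_mem
  obtain ⟨c, hc⟩ := prod_mem
  rw [mem_evenAnnihilator] at hr ⊢
  rw [← hc, mul_smul_comm, hr, smul_zero]

theorem oddKrullDim_eq_iff [Nontrivial (𝒜 0)] :
    oddKrullDim 𝒜 = t ↔ IsSystemOfOddParameters 𝒜 fun i => ⟨x i, (x i).2⟩ := by
  refine ⟨fun hdim => ?_, fun hsys => le_antisymm ?_ ?_⟩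
  · obtain _ | t := t
    · exact isSystemOfOddParameters_zero 𝒜 _
    by_contra hnot
    have length_le {s : ℕ} (hs : ∃ y : Fin s → 𝒜 1, IsSystemOfOddParameters 𝒜 y) : s ≤ t := by
      obtain ⟨y, hy⟩ := hs
      refine Nat.le_of_lt_succ ((length_le_of_isSystemOfOddParameters 𝒜 hx hy).lt_of_ne ?_)
      rintro rfl
      exact hnot (isSystemOfOddParameters_of_evenAnnihilator_le 𝒜 hy
        (evenAnnihilator_prod_le_of_generators 𝒜 hx y))
    have dim_le : oddKrullDim 𝒜 ≤ t := iSup₂_le fun s hs => by exact_mod_cast length_le hs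
    rw [hdim] at dim_le
    exact t.lt_irrefl (by exact_mod_cast dim_le)
  · exact iSup₂_le fun s ⟨y, hy⟩ => by
      exact_mod_cast length_le_of_isSystemOfOddParameters 𝒜 hx hy
  · exact le_iSup₂_of_le (f := fun (s : ℕ) (_ : ∃ y : Fin s → 𝒜 1, IsSystemOfOddParameters 𝒜 y) =>
      (s : ℕ∞)) t ⟨_, hsys⟩ le_rfl

theorem ker_evenToBar_le_evenAnnihilator :
    RingHom.ker (evenToBar 𝒜) ≤ evenAnnihilator 𝒜 (List.ofFn fun i => (x i : A)).prod := by
  intro r hr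
  have mul_mem : (r : A) * (List.ofFn fun i => (x i : A)).prod ∈ oddIdeal 𝒜 ^ (1 + t) :=
    GrPiece.mul_mem_pow ((Submodule.pow_one _).ge ((evenToQuotient_eq_zero_iff 𝒜).1 hr))
      (prod_mem_oddIdeal_pow 𝒜 x)
  rwa [add_comm, oddIdeal_pow_eq_bot 𝒜 hx] at mul_mem

theorem isSystemOfOddParameters_iff_evenAnnihilator_le_ker [IsNoetherianSuperRing 𝒜]
    [IsRegularLocalRing (A ⧸ oddIdeal 𝒜)] :
    (IsSystemOfOddParameters 𝒜 fun i => ⟨x i, (x i).2⟩) ↔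
      evenAnnihilator 𝒜 (List.ofFn fun i => (x i : A)).prod ≤ RingHom.ker (evenToBar 𝒜) := by
  have := isDomain_of_isRegularLocalRing (A ⧸ oddIdeal 𝒜)
  refine ⟨fun hsys => ?_, fun hle => ?_⟩
  · refine le_ker_of_ringKrullDim_le_quotient (evenToBar_surjective 𝒜)
      (ker_evenToBar_le_evenAnnihilator 𝒜 hx) ?_
    exact (ringKrullDim_even_eq_bar 𝒜).ge.trans hsys.le
  · exact isSystemOfOddParameters_of_evenAnnihilator_le_nilradical 𝒜
      (hle.trans (ker_evenToBar_le_nilradical 𝒜))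

theorem evenAnnihilator_le_ker_iff_smul_eq_zero :
    evenAnnihilator 𝒜 (List.ofFn fun i => (x i : A)).prod ≤ RingHom.ker (evenToBar 𝒜) ↔
      ∀ c : A ⧸ oddIdeal 𝒜, c • exteriorToGr 𝒜
        (ExteriorAlgebra.ιMulti (A ⧸ oddIdeal 𝒜) t (oddClass 𝒜 ∘ x)) = 0 → c = 0 := by
  rw [(evenToBar_surjective 𝒜).forall]
  refine forall_congr' fun r => ?_
  rw [smul_exteriorToGr_ιMulti_eq_zero_iff, oddIdeal_pow_eq_bot 𝒜 hx]
  rfl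

end Generators

end SuperRing

end OddParameters

section OddClassBasis

open IsLocalRing

theorem exists_span_range_eq_top_spanFinrank {R M : Type*} [Semiring R] [AddCommMonoid M]
    [Module R M] (N : Submodule R M) [Module.Finite R N] :
    ∃ x : Fin N.spanFinrank → N, Submodule.span R (Set.range x) = ⊤ := by
  obtain ⟨s, hs, hspan⟩ := Submodule.FG.exists_span_finset_card_eq_spanFinrank
    (Module.Finite.fg_top (R := R) (M := N))
  rw [Submodule.spanFinrank_top] at hs
  let e := s.equivFinOfCardEq hs
  refine ⟨Subtype.val ∘ e.symm, ?_⟩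
  rwa [e.symm.surjective.range_comp, Subtype.range_coe]

namespace SuperRing

variable {A : Type*} [Ring A] (𝒜 : ZMod 2 → AddSubgroup A) [GradedRing 𝒜] [IsSuperCommutative 𝒜]

instance ringHomSurjective_evenToBar : RingHomSurjective (evenToBar 𝒜) :=
  ⟨evenToBar_surjective 𝒜⟩

theorem span_range_oddClass_comp {t : ℕ} {x : Fin t → gradedPart 𝒜 1} :
    Submodule.span (A ⧸ oddIdeal 𝒜) (Set.range (oddClass 𝒜 ∘ x)) =
      (Submodule.span (𝒜 0) (Set.range x)).map (oddClass 𝒜) := by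
  rw [Submodule.map_span, Set.range_comp]

theorem span_range_oddClass_comp_eq_top {t : ℕ} {x : Fin t → gradedPart 𝒜 1}
    (hx : Submodule.span (𝒜 0) (Set.range x) = ⊤) :
    Submodule.span (A ⧸ oddIdeal 𝒜) (Set.range (oddClass 𝒜 ∘ x)) = ⊤ := by
  rw [span_range_oddClass_comp, hx, Submodule.map_top,
    LinearMap.range_eq_top.2 (oddClass_surjective 𝒜)]

theorem evenAnnihilator_le_ker_iff {t : ℕ} {x : Fin t → gradedPart 𝒜 1}
    (hx : Submodule.span (𝒜 0) (Set.range x) = ⊤) :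
    evenAnnihilator 𝒜 (List.ofFn fun i => (x i : A)).prod ≤ RingHom.ker (evenToBar 𝒜) ↔
      (∃ b : Module.Basis (Fin t) (A ⧸ oddIdeal 𝒜) (GrPiece (oddIdeal 𝒜) 1),
        ⇑b = oddClass 𝒜 ∘ x) ∧ Function.Injective (exteriorToGr 𝒜) := by
  rw [evenAnnihilator_le_ker_iff_smul_eq_zero 𝒜 hx]
  refine ⟨fun h => ?_, ?_⟩
  · have linearIndependent : LinearIndependent (A ⧸ oddIdeal 𝒜) (oddClass 𝒜 ∘ x) :=
      linearIndependent_of_alternatingMap_smul_eq_zero (N := AssocGr (oddIdeal 𝒜))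
        (g := (exteriorToGr 𝒜).toLinearMap.compAlternatingMap (ExteriorAlgebra.ιMulti _ t)) h
    let b := Module.Basis.mk linearIndependent (span_range_oddClass_comp_eq_top 𝒜 hx).ge
    have hb : ⇑b = oddClass 𝒜 ∘ x := Module.Basis.coe_mk _ _
    refine ⟨⟨b, hb⟩, ?_⟩
    exact (exteriorAlgebra_injective_iff_of_basis (B := AssocGr (oddIdeal 𝒜)) b _).2 (hb ▸ h)
  · rintro ⟨⟨b, hb⟩, hinj⟩
    exact hb ▸ (exteriorAlgebra_injective_iff_of_basis (B := AssocGr (oddIdeal 𝒜)) b _).1 hinj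

variable [IsNoetherianSuperRing 𝒜]

instance finite_grPiece_one : Module.Finite (A ⧸ oddIdeal 𝒜) (GrPiece (oddIdeal 𝒜) 1) :=
  Module.Finite.of_surjective (oddClass 𝒜) (oddClass_surjective 𝒜)

variable [IsLocalSuperRing 𝒜]

theorem span_eq_top_of_span_oddClass {t : ℕ} {x : Fin t → gradedPart 𝒜 1}
    (hx : Submodule.span (A ⧸ oddIdeal 𝒜) (Set.range (oddClass 𝒜 ∘ x)) = ⊤) :
    Submodule.span (𝒜 0) (Set.range x) = ⊤ := by
  refine eq_top_iff.2 (Submodule.le_of_le_smul_of_le_jacobson_bot (IsNoetherian.noetherian _)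
    (maximalIdeal_le_jacobson ⊥) fun y _ => ?_)
  obtain ⟨z, hz, hzy⟩ : oddClass 𝒜 y ∈ (Submodule.span (𝒜 0) (Set.range x)).map (oddClass 𝒜) := by
    rw [← span_range_oddClass_comp, hx]
    exact Submodule.mem_top
  have sub_mem_sq : ((y - z : gradedPart 𝒜 1) : A) ∈ oddIdeal 𝒜 ^ 2 :=
    (degreeOneClass_eq_zero_iff 𝒜).1 (by rw [map_sub, hzy, sub_self])
  have sub_mem := (odd_mem_sq_iff 𝒜 (y - z).2).1 (oddIdeal_sq_le 𝒜 sub_mem_sq)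
  rw [← Submodule.mem_smul_top_iff] at sub_mem
  exact add_sub_cancel z y ▸ Submodule.add_mem_sup hz sub_mem

variable [Module.Free (A ⧸ oddIdeal 𝒜) (GrPiece (oddIdeal 𝒜) 1)]

theorem exists_basis_oddClass :
    ∃ x : Fin (Module.finrank (A ⧸ oddIdeal 𝒜) (GrPiece (oddIdeal 𝒜) 1)) → gradedPart 𝒜 1,
      Submodule.span (𝒜 0) (Set.range x) = ⊤ ∧
        ∃ b : Module.Basis _ (A ⧸ oddIdeal 𝒜) (GrPiece (oddIdeal 𝒜) 1), ⇑b = oddClass 𝒜 ∘ x := by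
  let b := Module.finBasis (A ⧸ oddIdeal 𝒜) (GrPiece (oddIdeal 𝒜) 1)
  choose x hx using fun i => oddClass_surjective 𝒜 (b i)
  have hb : ⇑b = oddClass 𝒜 ∘ x := (funext hx).symm
  exact ⟨x, span_eq_top_of_span_oddClass 𝒜 (hb ▸ b.span_eq), b, hb⟩

theorem spanFinrank_eq_finrank : (gradedPart 𝒜 1).spanFinrank =
    Module.finrank (A ⧸ oddIdeal 𝒜) (GrPiece (oddIdeal 𝒜) 1) := by
  rw [← Submodule.spanFinrank_top]
  apply le_antisymm
  · obtain ⟨x, hx, -⟩ := exists_basis_oddClass 𝒜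
    rw [← hx]
    refine (Submodule.spanFinrank_span_le_ncard_of_finite (Set.finite_range x)).trans ?_
    simpa only [Set.image_univ, Set.ncard_univ, Nat.card_fin] using
      Set.ncard_image_le (f := x) Set.finite_univ
  · have map_le := Submodule.spanFinrank_map_le_of_fg (oddClass 𝒜)
      (p := (⊤ : Submodule (𝒜 0) (gradedPart 𝒜 1))) (IsNoetherian.noetherian _)
    rwa [Submodule.map_top, LinearMap.range_eq_top.2 (oddClass_surjective 𝒜),
      ← Module.finrank_eq_spanFinrank_of_free] at map_le

end SuperRing

end OddClassBasis

open SuperRing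

theorem mainTheorem2 {A : Type*} [Ring A] (𝒜 : ZMod 2 → AddSubgroup A) [GradedRing 𝒜]
    [IsSuperCommutative 𝒜] [IsNoetherianSuperRing 𝒜] [IsLocalSuperRing 𝒜] :
    List.TFAE [
      IsRegularLocalSuperRing 𝒜,
      IsRegularLocalRing (A ⧸ oddIdeal 𝒜) ∧
        Module.Free (A ⧸ oddIdeal 𝒜) (GrPiece (oddIdeal 𝒜) 1) ∧
        Function.Bijective (exteriorToGr 𝒜),
      IsRegularLocalRing (A ⧸ oddIdeal 𝒜) ∧
        (Module.Free (A ⧸ oddIdeal 𝒜) (GrPiece (oddIdeal 𝒜) 1) ∧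
          (Module.finrank (A ⧸ oddIdeal 𝒜) (GrPiece (oddIdeal 𝒜) 1) : ℕ∞) = oddKrullDim 𝒜) ∧
        Function.Bijective (exteriorToGr 𝒜)] := by
  tfae_have 1 → 3 := by
    intro hregular
    obtain ⟨hbar, hdim⟩ := (isRegularLocalSuperRing_iff 𝒜).1 hregular
    obtain ⟨x, hx⟩ := exists_span_range_eq_top_spanFinrank (gradedPart 𝒜 1)
    have hann := (isSystemOfOddParameters_iff_evenAnnihilator_le_ker 𝒜 hx).1
      ((oddKrullDim_eq_iff 𝒜 hx).1 hdim)
    obtain ⟨⟨b, -⟩, hinj⟩ := (evenAnnihilator_le_ker_iff 𝒜 hx).1 hann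
    have hfree := Module.Free.of_basis b
    exact ⟨hbar, ⟨hfree, by rw [hdim, spanFinrank_eq_finrank]⟩, hinj, exteriorToGr_surjective 𝒜⟩
  tfae_have 3 → 2 := fun ⟨hbar, ⟨hfree, _⟩, hbij⟩ => ⟨hbar, hfree, hbij⟩
  tfae_have 2 → 1 := by
    rintro ⟨hbar, hfree, hinj, -⟩
    obtain ⟨x, hx, hb⟩ := exists_basis_oddClass 𝒜
    have hann := (evenAnnihilator_le_ker_iff 𝒜 hx).2 ⟨hb, hinj⟩
    have hsys := (isSystemOfOddParameters_iff_evenAnnihilator_le_ker 𝒜 hx).2 hann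
    refine (isRegularLocalSuperRing_iff 𝒜).2 ⟨hbar, ?_⟩
    rw [spanFinrank_eq_finrank, (oddKrullDim_eq_iff 𝒜 hx).2 hsys]
  tfae_finish
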